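/- **Setting.** Let $m\ge 0$ and $\omega(\mathbf k)=\sqrt{m^2+|\mathbf k|^2}$. Let $M=\mathbb R^3$ if $m>0$ and $M=\mathbb R^3\setminus\{0\}$ if $m=0$; a point $\mathbf k\in M$ stands for the four-momentum $k=(\omega(\mathbf k),\mathbf k)$. Let $E\to M$ be a particle bundle of mass $m$: a smooth Hermitian complex vector bundle of finite nonzero rank with a smooth, fiberwise unitary, irreducible action $\Sigma$ of the proper orthochronous Poincaré group $\mathrm{ISO}^+(3,1)$ covering its action on momenta, in which the translation by $a=(a^0,\mathbf a)$ acts on the fiber $E(\mathbf k)$ as multiplication by $e^{i(\omega(\mathbf k) a^0-\mathbf k\cdot\mathbf a)}$. On sections put $(\tilde\Sigma_g\psi)(\mathbf k)=\Sigma_g[\psi(g^{-1}\mathbf k)]$, and for $a=1,2,3$ $$J_a\psi=i\tfrac{d}{dt}\Big|_{t=0}\tilde\Sigma_{R_a(t)}\psi,\quad K_a\psi=-i\tfrac{d}{dt}\Big|_{t=0}\tilde\Sigma_{\Lambda_a(t)}\psi,\quad (P_a\psi)(\mathbf k)=k_a\psi(\mathbf k),\quad (H\psi)(\mathbf k)=\omega(\mathbf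 k)\psi(\mathbf k),$$ where $R_a(t)$ is the rotation by the angle $t$ about the $a$-th axis and $\Lambda_a(t)$ the boost with rapidity $t$ along it. Write $\hat{\mathbf P}=\mathbf P/|\mathbf P|$, and $X\cdot\mathbf D=\sum_a X^aD_a$ for a vector field $X$ with (complex) smooth Cartesian components $X^a$. Let $\tilde E$ be the restriction of $E$ to $\mathbb R^3\setminus\{0\}$ (so $\tilde E=E$ if $m=0$). **Theorem 7 (Rotation connection).** On smooth sections of $\tilde E$ the two expressions $$\mathbf D^R=-i\Big(\frac{\hat{\mathbf P}\times\mathbf J}{|\mathbf P|}+\frac1H\hat{\mathbf P}(\hat{\mathbf P}\cdot\mathbf K)-\frac{i\mathbf P}{2H^2}\Big) =-i\Big(\frac{\hat{\mathbf P}\times\mathbf J}{|\mathbf P|}-\frac{i\hat{\mathbf P}}{|\mathbf P|}\Big)-\frac i2\Big(\frac1H\hat{\mathbf P}(\hat{\mathbf P}\cdot\mathbf K)+(\mathbf K\cdot\hat{\mathbf P})\hat{\mathbf P}\frac1H\Big)$$ agree, and: 1. $\mathbf D^R$ is a connection on $\tilde E$: $(X,\psi)\mapsto D^R_X\psi=X\cdot\mathbf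 D^R\psi$ takes smooth vector fields and smooth sections to smooth sections, is linear over smooth complex functions in $X$, and is additive in $\psi$ with $D^R_X(f\psi)=df(X)\psi+fD^R_X\psi$ for smooth $f:\mathbb R^3\setminus\{0\}\to\mathbb C$. 2. $\mathbf D^R$ is anti-Hermitian: with $\langle\psi,\zeta\rangle=\int\frac{d^3k}{\omega}\langle\psi(\mathbf k),\zeta(\mathbf k)\rangle$ and $Q_a=iD^R_a$, one has $\langle Q_a\psi,\zeta\rangle=\langle\psi,Q_a\zeta\rangle$ for $a=1,2,3$ and all smooth sections $\psi,\zeta$ of $\tilde E$ such that $\psi,\zeta,Q_a\psi,Q_a\zeta$ are square integrable with respect to $d^3k/\omega$. 3. It transports along spheres by rotations: let $\mathbf k\ne0$ and let $R:\mathbb R\to\mathrm{SO}(3)$ be smooth with $R(0)=1$ and $\frac{d}{dt}R(t)\mathbf x=\boldsymbol\Omega(t)\times R(t)\mathbf x$ for all $\mathbf x\in\mathbb R^3$, where $\boldsymbol\Omega(t)\cdot R(t)\mathbf k=0$ for all $t$. Then the parallel transport of $\mathbf D^R$ along the curve $t\mapsto R(t)\mathbf k$ is $\Sigma_{R(t)}:E(\mathbf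 k)\to E(R(t)\mathbf k)$. 4. It transports radially by boosts, up to a normalizing scalar: let $\mathbf k=r\mathbf n$ with $r>0$, $|\mathbf n|=1$, and let $\Lambda_{\mathbf n}(\eta)$ be the boost along $\mathbf n$ with rapidity $\eta$. Along $\eta\mapsto\Lambda_{\mathbf n}(\eta)\mathbf k$, for those $\eta$ for which this point lies on the open ray $\{s\mathbf n: s>0\}$, the parallel transport of $\mathbf D^R$ is $\big(\omega(\Lambda_{\mathbf n}(\eta)\mathbf k)/\omega(\mathbf k)\big)^{1/2}\,\Sigma_{\Lambda_{\mathbf n}(\eta)}:E(\mathbf k)\to E(\Lambda_{\mathbf n}(\eta)\mathbf k)$. -/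

import Mathlib

open Bundle Manifold ContDiff Topology MeasureTheory

noncomputable section

namespace Particle

/-! ### Minkowski space and the Poincaré group -/

/-- Three-dimensional Euclidean (momentum or position) space. -/
abbrev R3 := EuclideanSpace ℝ (Fin 3)

/-- Four-vectors `(p⁰, p)` (time component, spatial part). -/
abbrev Spacetime := ℝ × R3

/-- The Minkowski product, with signature `(+,-,-,-)`. -/
def minkowski (p q : Spacetime) : ℝ := p.1 * q.1 - inner ℝ p.2 q.2

/-- The vector product of `ℝ³`. -/
def cross (x y : R3) : R3 := WithLp.toLp 2 (crossProduct x.ofLp y.ofLp)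

/-- The proper orthochronous Lorentz group: linear automorphisms of Minkowski space which preserve
the Minkowski product, have determinant one, and preserve the future among causal vectors. -/
def properLorentz : Subgroup (Spacetime ≃ₗ[ℝ] Spacetime) where
  carrier := {L | (∀ p q, minkowski (L p) (L q) = minkowski p q) ∧
    LinearMap.det (L : Spacetime →ₗ[ℝ] Spacetime) = 1 ∧
    ∀ p, 0 ≤ minkowski p p → (0 < (L p).1 ↔ 0 < p.1)}
  mul_mem' := by
    rintro A B ⟨hA, hA', hA''⟩ ⟨hB, hB', hB''⟩
    refine ⟨fun p q => ?_, ?_, fun p hp => ?_⟩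
    · rw [LinearEquiv.mul_apply, LinearEquiv.mul_apply, hA, hB]
    · have : ((A * B : Spacetime ≃ₗ[ℝ] Spacetime) : Spacetime →ₗ[ℝ] Spacetime) =
        (A : Spacetime →ₗ[ℝ] Spacetime) * (B : Spacetime →ₗ[ℝ] Spacetime) := rfl
      rw [this, map_mul, hA', hB', one_mul]
    · rw [LinearEquiv.mul_apply, hA'' _ (by rw [hB]; exact hp), hB'' _ hp]
  one_mem' := ⟨fun _ _ => rfl, LinearMap.det_id, fun _ _ => Iff.rfl⟩
  inv_mem' := by
    rintro A ⟨hA, hA', hA''⟩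
    have hinv : ∀ p, A (A⁻¹ p) = p := fun p => A.apply_symm_apply p
    have hpres : ∀ p q, minkowski (A⁻¹ p) (A⁻¹ q) = minkowski p q := fun p q => by
      rw [← hA, hinv, hinv]
    refine ⟨hpres, ?_, fun p hp => ?_⟩
    · have h1 := LinearEquiv.det_mul_det_symm A
      rw [hA', one_mul] at h1
      exact h1
    · rw [← hA'' _ (by rw [hpres]; exact hp), hinv]

/-- The (proper orthochronous) Poincaré group `ISO⁺(3,1)`: affine automorphisms of Minkowski space
whose linear part is a proper orthochronous Lorentz transformation. -/
def Poincare : Subgroup (Spacetime ≃ᵃ[ℝ] Spacetime) :=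
  properLorentz.comap AffineEquiv.linearHom

/-- A Lorentz transformation as an element of the Poincaré group. -/
def lorentz (L : Spacetime ≃ₗ[ℝ] Spacetime) (hL : L ∈ properLorentz) : Poincare :=
  ⟨L.toAffineEquiv, hL⟩

/-- The spacetime translation by `a`. -/
def translation (a : Spacetime) : Poincare :=
  ⟨AffineEquiv.constVAdd ℝ Spacetime a, by
    change AffineEquiv.linearHom (AffineEquiv.constVAdd ℝ Spacetime a) ∈ properLorentz
    have : AffineEquiv.linearHom (AffineEquiv.constVAdd ℝ Spacetime a) = 1 := rfl
    rw [this]; exact one_mem _⟩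

/-- The Minkowski product as a bilinear form. -/
def minkowskiForm : LinearMap.BilinForm ℝ Spacetime :=
  LinearMap.mk₂ ℝ minkowski
    (fun p p' q => by simp [minkowski, inner_add_left]; ring)
    (fun c p q => by simp [minkowski, inner_smul_left]; ring)
    (fun p q q' => by simp [minkowski, inner_add_right]; ring)
    (fun c p q => by simp [minkowski, inner_smul_right]; ring)

theorem det_sq_eq_one (L : Spacetime ≃ₗ[ℝ] Spacetime)
    (h : ∀ p q, minkowski (L p) (L q) = minkowski p q) :
    LinearMap.det (L : Spacetime →ₗ[ℝ] Spacetime) ^ 2 = 1 := by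
  let b := Module.finBasis ℝ Spacetime
  have key : ∀ p : Spacetime, minkowski p (p.1, -p.2) = 0 → p = 0 := by
    intro p hp
    have h1 : p.1 * p.1 + ‖p.2‖ ^ 2 = 0 := by
      simpa [minkowski, inner_neg_right, real_inner_self_eq_norm_sq] using hp
    have h2 : p.1 = 0 := by nlinarith [sq_nonneg ‖p.2‖, mul_self_nonneg p.1]
    have h3 : ‖p.2‖ = 0 := by nlinarith [sq_nonneg ‖p.2‖, mul_self_nonneg p.1]
    exact Prod.ext h2 (norm_eq_zero.mp h3)
  have hsymm : ∀ p q, minkowski p q = minkowski q p := fun p q => by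
    simp only [minkowski, real_inner_comm, mul_comm]
  have hnd : minkowskiForm.Nondegenerate :=
    ⟨fun p hp => key p (hp _), fun p hp => key p ((hsymm _ _).trans (hp _))⟩
  have hdet := (LinearMap.BilinForm.nondegenerate_iff_det_ne_zero b).mp hnd
  have hcomp : minkowskiForm.comp (L : Spacetime →ₗ[ℝ] Spacetime) L = minkowskiForm := by
    ext p q <;> exact h _ _
  have h4 := LinearMap.BilinForm.toMatrix_comp b b minkowskiForm
    (L : Spacetime →ₗ[ℝ] Spacetime) L
  rw [hcomp] at h4
  have h5 := congrArg Matrix.det h4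
  rw [Matrix.det_mul, Matrix.det_mul, Matrix.det_transpose, LinearMap.det_toMatrix] at h5
  have h6 : (LinearMap.BilinForm.toMatrix b minkowskiForm).det *
      (LinearMap.det (L : Spacetime →ₗ[ℝ] Spacetime) ^ 2 - 1) = 0 := by linear_combination -h5
  linarith [(mul_eq_zero.mp h6).resolve_left hdet]

/-- The group `SO(3)`. -/
abbrev SO3 := Matrix.specialOrthogonalGroup (Fin 3) ℝ

/-- The linear automorphism `(p⁰, p) ↦ (p⁰, R p)` of Minkowski space. -/
def rotationEquiv (R : SO3) : Spacetime ≃ₗ[ℝ] Spacetime :=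
  LinearEquiv.prodCongr (LinearEquiv.refl ℝ ℝ)
    (LinearEquiv.ofLinearMap (Matrix.toEuclideanLin (R : Matrix (Fin 3) (Fin 3) ℝ))
      (Matrix.toEuclideanLin (R : Matrix (Fin 3) (Fin 3) ℝ).transpose)
      (by
        have h := (Matrix.mem_specialOrthogonalGroup_iff.mp R.2).1
        have h' := (Matrix.mem_orthogonalGroup_iff _ _).mp h
        ext x i
        simp [Matrix.toLpLin_apply, Matrix.mulVec_mulVec, h'])
      (by
        have h := (Matrix.mem_specialOrthogonalGroup_iff.mp R.2).1
        have h' := (Matrix.mem_orthogonalGroup_iff' _ _).mp h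
        ext x i
        simp [Matrix.toLpLin_apply, Matrix.mulVec_mulVec, h']))

theorem rotationEquiv_mem (R : SO3) : rotationEquiv R ∈ properLorentz := by
  have h := (Matrix.mem_specialOrthogonalGroup_iff.mp R.2).1
  have h' := (Matrix.mem_orthogonalGroup_iff' _ _).mp h
  refine ⟨fun p q => ?_, ?_, fun p _ => Iff.rfl⟩
  · change p.1 * q.1 - inner ℝ (Matrix.toEuclideanLin (R : Matrix (Fin 3) (Fin 3) ℝ) p.2)
      (Matrix.toEuclideanLin (R : Matrix (Fin 3) (Fin 3) ℝ) q.2) = _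
    simp [Matrix.toLpLin_apply, EuclideanSpace.inner_eq_star_dotProduct, minkowski,
      Matrix.dotProduct_mulVec, ← Matrix.mulVec_transpose, h']
  · change LinearMap.det (LinearMap.prodMap (LinearMap.id : ℝ →ₗ[ℝ] ℝ)
      (Matrix.toEuclideanLin (R : Matrix (Fin 3) (Fin 3) ℝ))) = 1
    rw [LinearMap.det_prodMap, LinearMap.det_id, one_mul, Matrix.toEuclideanLin,
      Matrix.toLpLin_eq_toLin, LinearMap.det_toLin]
    exact (Matrix.mem_specialOrthogonalGroup_iff.mp R.2).2

/-- A spatial rotation as an element of the Poincaré group. -/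
def rotation (R : SO3) : Poincare := lorentz (rotationEquiv R) (rotationEquiv_mem R)

/-- The matrix of the (right-handed) rotation by the angle `t` about the coordinate axis `a`. -/
def axisMatrix (a : Fin 3) (t : ℝ) : Matrix (Fin 3) (Fin 3) ℝ :=
  match a with
  | 0 => !![1, 0, 0; 0, Real.cos t, -Real.sin t; 0, Real.sin t, Real.cos t]
  | 1 => !![Real.cos t, 0, Real.sin t; 0, 1, 0; -Real.sin t, 0, Real.cos t]
  | 2 => !![Real.cos t, -Real.sin t, 0; Real.sin t, Real.cos t, 0; 0, 0, 1]

/-- The (right-handed) rotation by the angle `t` about the coordinate axis `a`. -/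
def axisRotation (a : Fin 3) (t : ℝ) : SO3 :=
  ⟨axisMatrix a t, by
    have hcs := Real.sin_sq_add_cos_sq t
    rw [Matrix.mem_specialOrthogonalGroup_iff, Matrix.mem_orthogonalGroup_iff]
    constructor
    · ext i j
      fin_cases a <;> fin_cases i <;> fin_cases j <;>
        simp [axisMatrix, Matrix.mul_apply, Fin.sum_univ_three] <;> linarith
    · fin_cases a <;> simp [axisMatrix, Matrix.det_fin_three] <;> linarith⟩

/-- The boost with rapidity `η` in the direction of the vector `n` (meant for unit vectors). -/
def boostMap (n : R3) (η : ℝ) : Spacetime →ₗ[ℝ] Spacetime where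
  toFun p := (Real.cosh η * p.1 + Real.sinh η * inner ℝ n p.2,
    p.2 + (Real.sinh η * p.1 + (Real.cosh η - 1) * inner ℝ n p.2) • n)
  map_add' p q := by
    refine Prod.ext ?_ ?_
    · simp [inner_add_right]; ring
    · simp only [Prod.snd_add, Prod.fst_add, inner_add_right]; module
  map_smul' c p := by
    refine Prod.ext ?_ ?_
    · simp [inner_smul_right]; ring
    · simp only [Prod.smul_snd, Prod.smul_fst, inner_smul_right, RingHom.id_apply, smul_eq_mul]
      module

theorem boostMap_comp (n : Metric.sphere (0 : R3) 1) (η ξ : ℝ) (p : Spacetime) :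
    boostMap n η (boostMap n ξ p) = boostMap n (η + ξ) p := by
  have hn : inner ℝ (n : R3) (n : R3) = (1 : ℝ) := by
    rw [real_inner_self_eq_norm_sq, norm_eq_of_mem_sphere, one_pow]
  refine Prod.ext ?_ ?_
  · simp only [boostMap, LinearMap.coe_mk, AddHom.coe_mk, inner_add_right, inner_smul_right, hn,
      Real.cosh_add, Real.sinh_add]
    ring
  · simp only [boostMap, LinearMap.coe_mk, AddHom.coe_mk, inner_add_right, inner_smul_right, hn,
      Real.cosh_add, Real.sinh_add]
    module

theorem boostMap_zero (n : R3) (p : Spacetime) : boostMap n 0 p = p := by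
  refine Prod.ext ?_ ?_ <;> simp [boostMap]

/-- The boost with rapidity `η` in the direction of the unit vector `n`, as a linear automorphism:
on the momentum `(ω, k)` it produces `k + η ω n + O(η²)`. -/
def boostEquiv (n : Metric.sphere (0 : R3) 1) (η : ℝ) : Spacetime ≃ₗ[ℝ] Spacetime :=
  LinearEquiv.ofLinearMap (boostMap n η) (boostMap n (-η))
    (by ext1 <;> ext1 <;> simp [boostMap_comp, boostMap_zero])
    (by ext1 <;> ext1 <;> simp [boostMap_comp, boostMap_zero])

theorem boostEquiv_mem (n : Metric.sphere (0 : R3) 1) (η : ℝ) :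
    boostEquiv n η ∈ properLorentz := by
  have hn : inner ℝ (n : R3) (n : R3) = (1 : ℝ) := by
    rw [real_inner_self_eq_norm_sq, norm_eq_of_mem_sphere, one_pow]
  have hpres : ∀ η p q, minkowski (boostEquiv n η p) (boostEquiv n η q) = minkowski p q := by
    intro η p q
    change minkowski (boostMap n η p) (boostMap n η q) = _
    have hc := Real.cosh_sq η
    simp only [minkowski, boostMap, LinearMap.coe_mk, AddHom.coe_mk, inner_add_right,
      inner_smul_right, inner_add_left, inner_smul_left, hn, real_inner_comm (n : R3) p.2,
      conj_trivial]
    linear_combination (p.1 * q.1 - inner ℝ (n : R3) p.2 * inner ℝ (n : R3) q.2) * hc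
  have hpos : ∀ η p, 0 ≤ minkowski p p → 0 < p.1 → 0 < (boostEquiv n η p).1 := by
    intro η p hp hp0
    change 0 < Real.cosh η * p.1 + Real.sinh η * inner ℝ (n : R3) p.2
    have h1 : ‖p.2‖ ≤ p.1 := by
      have : ‖p.2‖ ^ 2 ≤ p.1 ^ 2 := by
        rw [minkowski, real_inner_self_eq_norm_sq] at hp; nlinarith
      exact (sq_le_sq₀ (norm_nonneg _) hp0.le).mp this
    have h2 : |inner ℝ (n : R3) p.2| ≤ p.1 := by
      refine (abs_real_inner_le_norm _ _).trans ?_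
      rwa [norm_eq_of_mem_sphere, one_mul]
    have h3 : |Real.sinh η| < Real.cosh η := by
      refine abs_lt.mpr ⟨?_, Real.sinh_lt_cosh η⟩
      linarith [Real.exp_pos η, Real.cosh_add_sinh η]
    have h4 : |Real.sinh η * inner ℝ (n : R3) p.2| < Real.cosh η * p.1 := by
      rw [abs_mul]
      exact lt_of_le_of_lt (mul_le_mul_of_nonneg_left h2 (abs_nonneg _))
        (mul_lt_mul_of_pos_right h3 hp0)
    linarith [(abs_lt.mp h4).1]
  have hinv : ∀ p, boostEquiv n (-η) (boostEquiv n η p) = p := fun p => by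
    change boostMap n (-η) (boostMap n η p) = p
    rw [boostMap_comp, neg_add_cancel, boostMap_zero]
  refine ⟨hpres η, ?_, fun p hp => ⟨fun h => ?_, hpos η p hp⟩⟩
  · have h1 : (boostEquiv n η : Spacetime →ₗ[ℝ] Spacetime) =
        (boostEquiv n (η / 2) : Spacetime →ₗ[ℝ] Spacetime) * (boostEquiv n (η / 2)) := by
      refine LinearMap.ext fun p => ?_
      change boostMap n η p = boostMap n (η / 2) (boostMap n (η / 2) p)
      rw [boostMap_comp, add_halves]
    rw [h1, map_mul, ← sq, det_sq_eq_one _ (hpres _)]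
  · have := hpos (-η) _ (by rw [hpres]; exact hp) h
    rwa [hinv] at this

/-- The boost with rapidity `η` in the direction of the unit vector `n`, as an element of the
Poincaré group. -/
def boost (n : Metric.sphere (0 : R3) 1) (η : ℝ) : Poincare :=
  lorentz (boostEquiv n η) (boostEquiv_mem n η)

/-- The coordinate unit vectors. -/
def unitVec (a : Fin 3) : Metric.sphere (0 : R3) 1 :=
  ⟨EuclideanSpace.single a 1, by simp⟩

/-! ### The momentum manifold -/

/-- The energy `ω = √(m² + |k|²)` of a particle of mass `m` and momentum `k`. -/
def energy (m : ℝ) (k : R3) : ℝ := √(m ^ 2 + ‖k‖ ^ 2)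

/-- The momenta of a particle of mass `m`, parametrizing the mass hyperboloid or the forward light
cone: the `k ∈ ℝ³` of positive energy, that is, all of `ℝ³` for `m > 0` and `ℝ³ ∖ {0}` for
`m = 0`. -/
def shell (m : ℝ) : TopologicalSpace.Opens R3 :=
  ⟨{k | 0 < energy m k}, isOpen_lt continuous_const (by unfold energy; fun_prop)⟩

variable {m : ℝ}

/-- The four-momentum `(ω, k)`. -/
def fourMomentum (k : shell m) : Spacetime := (energy m k, k)

theorem minkowski_fourMomentum (k : shell m) :
    minkowski (fourMomentum k) (fourMomentum k) = m ^ 2 := by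
  have : (0 : ℝ) ≤ m ^ 2 + ‖(k : R3)‖ ^ 2 := by positivity
  simp only [minkowski, fourMomentum, energy, real_inner_self_eq_norm_sq,
    Real.mul_self_sqrt this]
  ring

theorem energy_of_minkowski {p : Spacetime} (hp : minkowski p p = m ^ 2) (h0 : 0 < p.1) :
    energy m p.2 = p.1 := by
  rw [minkowski, real_inner_self_eq_norm_sq] at hp
  rw [energy, ← hp, show p.1 * p.1 - ‖p.2‖ ^ 2 + ‖p.2‖ ^ 2 = p.1 ^ 2 by ring,
    Real.sqrt_sq h0.le]

theorem linear_fourMomentum (g : Poincare) (k : shell m) :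
    minkowski (g.1.linear (fourMomentum k)) (g.1.linear (fourMomentum k)) = m ^ 2 ∧
      0 < (g.1.linear (fourMomentum k)).1 := by
  have hk := minkowski_fourMomentum k
  exact ⟨(g.2.1 _ _).trans hk,
    (g.2.2.2 (fourMomentum k) (by rw [hk]; positivity)).mpr k.2⟩

/-- The action of the Poincaré group on momenta: the linear part acts on four-momenta. -/
instance : SMul Poincare (shell m) where
  smul g k := ⟨(g.1.linear (fourMomentum k)).2, by
    change 0 < energy m _
    have h := linear_fourMomentum g k
    rw [energy_of_minkowski h.1 h.2]
    exact h.2⟩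

theorem fourMomentum_smul (g : Poincare) (k : shell m) :
    fourMomentum (g • k) = g.1.linear (fourMomentum k) := by
  have h := linear_fourMomentum g k
  exact Prod.ext (energy_of_minkowski h.1 h.2) rfl

instance : MulAction Poincare (shell m) where
  one_smul _ := rfl
  mul_smul g h k := Subtype.ext (by
    change ((g * h).1.linear (fourMomentum k)).2 = (g.1.linear (fourMomentum (h • k))).2
    rw [fourMomentum_smul]; rfl)

/-- The momentum space with the origin removed. -/
def punctured (m : ℝ) : Set (shell m) := {k | (k : R3) ≠ 0}

/-! ### Particle bundles

A smooth complex vector bundle over the momentum manifold is given by fibers `E k`, a model fiber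
`F`, and Mathlib's vector bundle structures; each fiber carries a Hermitian inner product. -/

section Bundle

variable (F : Type*) [NormedAddCommGroup F] [NormedSpace ℂ F]
  (E : shell m → Type*) [TopologicalSpace (TotalSpace F E)]
  [∀ k, NormedAddCommGroup (E k)] [∀ k, InnerProductSpace ℂ (E k)] [FiberBundle F E]

variable {E} in
/-- Smoothness of a section over the set `U`. -/
def SmoothSection (U : Set (shell m)) (ψ : ∀ k, E k) : Prop :=
  ContMDiffOn 𝓘(ℝ, R3) (𝓘(ℝ, R3).prod 𝓘(ℝ, F)) ∞ (fun k => (⟨k, ψ k⟩ : TotalSpace F E)) U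

/-- The structure of a (bosonic, elementary) particle bundle of mass `m` on `E`: a Hermitian metric
depending smoothly on the base point and a smooth, unitary, irreducible action of the Poincaré group
covering its action on momenta, under which the translation by `a` acts on the states of
four-momentum `k` as multiplication by `exp (i k·a)`. -/
structure ParticleBundle where
  /-- The inner product of smooth sections is smooth. -/
  smooth_inner : ∀ (U : Set (shell m)), IsOpen U → ∀ ψ ζ : ∀ k, E k,
    SmoothSection F U ψ → SmoothSection F U ζ →
      ContMDiffOn 𝓘(ℝ, R3) 𝓘(ℝ, ℂ) ∞ (fun k => inner ℂ (ψ k) (ζ k)) U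
  /-- The action, a unitary map from the fiber at `k` to the fiber at `g k`. -/
  act : ∀ (g : Poincare) (k : shell m), E k ≃ₗᵢ[ℂ] E (g • k)
  act_one : ∀ (k : shell m) (v : E k),
    (⟨(1 : Poincare) • k, act 1 k v⟩ : TotalSpace F E) = ⟨k, v⟩
  act_mul : ∀ (g h : Poincare) (k : shell m) (v : E k),
    (⟨(g * h) • k, act (g * h) k v⟩ : TotalSpace F E) =
      ⟨g • h • k, act g (h • k) (act h k v)⟩
  /-- Smoothness of the action, tested on all smooth families of group elements. -/
  smooth_act : ∀ (n : ℕ) (γ : EuclideanSpace ℝ (Fin n) → Poincare),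
    (∀ x : Spacetime, ContDiff ℝ ∞ (fun t => (γ t).1 x)) →
      ContMDiff (𝓘(ℝ, EuclideanSpace ℝ (Fin n)).prod (𝓘(ℝ, R3).prod 𝓘(ℝ, F)))
        (𝓘(ℝ, R3).prod 𝓘(ℝ, F)) ∞
        (fun p : EuclideanSpace ℝ (Fin n) × TotalSpace F E =>
          (⟨γ p.1 • p.2.1, act (γ p.1) p.2.1 p.2.2⟩ : TotalSpace F E))
  act_translation : ∀ (a : Spacetime) (k : shell m) (v : E k),
    (⟨translation a • k, act (translation a) k v⟩ : TotalSpace F E) =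
      ⟨k, Complex.exp (Complex.I * (minkowski (fourMomentum k) a : ℝ)) • v⟩
  nontrivial : ∀ k, Nontrivial (E k)
  /-- There is no proper invariant subbundle. (The action on momenta is transitive, so an invariant
  family of subspaces of the fibers is automatically a smooth subbundle.) -/
  irreducible : ∀ W : ∀ k, Submodule ℂ (E k),
    (∀ (g : Poincare) (k : shell m), ∀ v ∈ W k, act g k v ∈ W (g • k)) →
      (∀ k, W k = ⊥) ∨ (∀ k, W k = ⊤)

end Bundle

/-! ### Operators on sections -/

section Operators

variable {F : Type*} [NormedAddCommGroup F] [NormedSpace ℂ F]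
  {E : shell m → Type*} [TopologicalSpace (TotalSpace F E)]
  [∀ k, NormedAddCommGroup (E k)] [∀ k, InnerProductSpace ℂ (E k)] [FiberBundle F E]

/-- An operator on sections of `E`. -/
abbrev Operator (E : shell m → Type*) := (∀ k, E k) → (∀ k, E k)

/-- A vector field on the momentum manifold (with complex coefficients), given by its Cartesian
components. -/
abbrev VectorField (m : ℝ) := shell m → Fin 3 → ℂ

/-- Smoothness of a vector field over the set `U`. -/
def SmoothField (U : Set (shell m)) (X : VectorField m) : Prop :=
  ∀ a, ContMDiffOn 𝓘(ℝ, R3) 𝓘(ℝ, ℂ) ∞ (fun k => X k a) U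

/-- The derivative `df(X)` of a function along a vector field. -/
def dirDeriv (f : shell m → ℂ) (X : VectorField m) (k : shell m) : ℂ :=
  ∑ a, X k a * mvfderiv 𝓘(ℝ, R3) f k (EuclideanSpace.single a 1 : R3)

/-- Identification of the fibers over equal points. -/
def fiberCast {k k' : shell m} (h : k = k') (v : E k) : E k' := h ▸ v

/-- The operator of multiplication by a real function. -/
def mulOp (f : shell m → ℝ) : Operator E := fun ψ k => (f k : ℂ) • ψ k

/-- The momentum operators `P_a`. -/
def opP (a : Fin 3) : Operator E := mulOp fun k => (k : R3) a

/-- The operators `P̂_a = P_a / |P|`. -/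
def opPhat (a : Fin 3) : Operator E := mulOp fun k => (k : R3) a / ‖(k : R3)‖

/-- The operator `1 / |P|`. -/
def opPinv : Operator E := mulOp fun k => ‖(k : R3)‖⁻¹

/-- The inverse `1 / H` of the Hamiltonian. -/
def opHinv : Operator E := mulOp fun k => (energy m k)⁻¹

/-- The cross product of two vector operators. -/
def opCross (A B : Fin 3 → Operator E) : Fin 3 → Operator E :=
  ![A 1 ∘ B 2 - A 2 ∘ B 1, A 2 ∘ B 0 - A 0 ∘ B 2, A 0 ∘ B 1 - A 1 ∘ B 0]

/-- The dot product of two vector operators. -/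
def opDot (A B : Fin 3 → Operator E) : Operator E := ∑ b, A b ∘ B b

/-- The pairing `X·D = ∑ Xᵃ D_a` of a vector operator with vector fields. -/
def alongField (D : Fin 3 → Operator E) (X : VectorField m) : Operator E :=
  fun ψ k => ∑ a, X k a • D a ψ k

namespace ParticleBundle

variable (B : ParticleBundle F E)

/-- The action of the Poincaré group on sections, `(g ψ)(k) = g (ψ (g⁻¹ k))`. -/
def actSection (g : Poincare) : Operator E :=
  fun ψ k => fiberCast (smul_inv_smul g k) (B.act g (g⁻¹ • k) (ψ (g⁻¹ • k)))

/-- The angular momentum operators. -/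
def opJ (a : Fin 3) : Operator E :=
  fun ψ k => Complex.I • deriv (fun t : ℝ => B.actSection (rotation (axisRotation a t)) ψ k) 0

/-- The boost operators. (Rapidity and velocity agree to first order.) -/
def opK (a : Fin 3) : Operator E :=
  fun ψ k => -Complex.I • deriv (fun t : ℝ => B.actSection (boost (unitVec a) t) ψ k) 0

/-- The Cartesian components of
`D^R = -i (P̂ × J / |P| + H⁻¹ P̂ (P̂·K) - i P / (2 H²))`. -/
def rotationComp (a : Fin 3) : Operator E :=
  -Complex.I • (opPinv ∘ opCross opPhat B.opJ a + opHinv ∘ opPhat a ∘ opDot opPhat B.opK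
    - (Complex.I / 2) • (opP a ∘ opHinv ∘ opHinv))

/-- The Cartesian components of the symmetrized expression
`-i (P̂ × J / |P| - i P̂ / |P|) - (i/2) (H⁻¹ P̂ (P̂·K) + (K·P̂) P̂ H⁻¹)`. -/
def rotationCompSymm (a : Fin 3) : Operator E :=
  -Complex.I • (opPinv ∘ opCross opPhat B.opJ a - Complex.I • (opPinv ∘ opPhat a))
    - (Complex.I / 2) • (opHinv ∘ opPhat a ∘ opDot opPhat B.opK
      + opDot B.opK opPhat ∘ opPhat a ∘ opHinv)

/-- The rotation connection `D^R`, as a map taking a vector field and a section to a section. -/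
def rotationConnection : VectorField m → Operator E := alongField B.rotationComp

/-- The boost by rapidity `η` along the unit vector `n`, from the fiber at `k` to the fiber at the
boosted momentum `k'`, multiplied by the factor `(ω(k') / ω(k))^{1/2}`. -/
def scaledBoost (n : Metric.sphere (0 : R3) 1) (k : shell m) (η : ℝ) :
    E k ≃ₗ[ℂ] E (boost n η • k) :=
  (B.act (boost n η) k).toLinearEquiv.trans
    (LinearEquiv.smulOfNeZero ℂ (E (boost n η • k))
      ((√(energy m (boost n η • k : shell m) / energy m k) : ℝ) : ℂ)
      (Complex.ofReal_ne_zero.mpr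
        (Real.sqrt_pos.mpr (div_pos (boost n η • k : shell m).2 k.2)).ne'))

end ParticleBundle

/-! ### Connections -/

variable (F) in
/-- `D` is a connection on the restriction of the bundle to the open set `U`: it is a map taking
smooth vector fields and smooth sections over `U` to smooth sections over `U` that is linear over
the smooth complex functions in the vector field, and additive with the Leibniz rule in the
section. Vector fields and sections over `U` are written as functions on the whole base whose
values outside `U` are irrelevant (`congr`). -/
structure IsConnectionOn (D : VectorField m → Operator E) (U : Set (shell m)) : Prop where
  congr : ∀ X Y ψ ζ, SmoothField U X → SmoothSection F U ψ →
    (∀ k ∈ U, X k = Y k) → (∀ k ∈ U, ψ k = ζ k) → ∀ k ∈ U, D X ψ k = D Y ζ k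
  smooth : ∀ X ψ, SmoothField U X → SmoothSection F U ψ → SmoothSection F U (D X ψ)
  add_field : ∀ X Y ψ, SmoothField U X → SmoothField U Y → SmoothSection F U ψ →
    ∀ k ∈ U, D (X + Y) ψ k = D X ψ k + D Y ψ k
  smul_field : ∀ (f : shell m → ℂ) X ψ, ContMDiffOn 𝓘(ℝ, R3) 𝓘(ℝ, ℂ) ∞ f U →
    SmoothField U X → SmoothSection F U ψ →
    ∀ k ∈ U, D (fun k => f k • X k) ψ k = f k • D X ψ k
  add_section : ∀ X ψ ζ, SmoothField U X → SmoothSection F U ψ → SmoothSection F U ζ →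
    ∀ k ∈ U, D X (ψ + ζ) k = D X ψ k + D X ζ k
  leibniz : ∀ (f : shell m → ℂ) X ψ, ContMDiffOn 𝓘(ℝ, R3) 𝓘(ℝ, ℂ) ∞ f U →
    SmoothField U X → SmoothSection F U ψ →
    ∀ k ∈ U, D X (fun k => f k • ψ k) k = dirDeriv f X k • ψ k + f k • D X ψ k

/-- The Lorentz invariant measure `d³k / ω` on the momentum manifold. -/
def invMeasure (m : ℝ) : Measure (shell m) :=
  (Measure.comap ((↑) : shell m → R3) volume).withDensity
    fun k => ENNReal.ofReal (energy m k)⁻¹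

/-- The inner product `∫ d³k / ω ⟨ψ, ζ⟩` of sections. -/
def secInner (ψ ζ : ∀ k, E k) : ℂ := ∫ k, inner ℂ (ψ k) (ζ k) ∂(invMeasure m)

/-- Square integrability of a section. -/
def SquareIntegrable (ψ : ∀ k, E k) : Prop :=
  Integrable (fun k => ‖ψ k‖ ^ 2) (invMeasure m)

/-- The constant vector field `e_a`. -/
def constField (a : Fin 3) : VectorField m := fun _ => Pi.single a 1

variable (F) in
/-- `D` is anti-Hermitian over `U`: the operators `Q_a = i D_a` satisfy `⟨Q_a ψ, ζ⟩ = ⟨ψ, Q_a ζ⟩`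
for all smooth sections `ψ`, `ζ` over `U` such that `ψ`, `ζ`, `Q_a ψ`, `Q_a ζ` are square
integrable. -/
def IsAntiHermitianOn (D : VectorField m → Operator E) (U : Set (shell m)) : Prop :=
  ∀ (a : Fin 3) (ψ ζ : ∀ k, E k), SmoothSection F U ψ → SmoothSection F U ζ →
    SquareIntegrable ψ → SquareIntegrable ζ →
    SquareIntegrable (D (constField a) ψ) → SquareIntegrable (D (constField a) ζ) →
    secInner (Complex.I • D (constField a) ψ) ζ = secInner ψ (Complex.I • D (constField a) ζ)

variable (F) in
/-- The linear isomorphisms `τ t : V → E (c t)` are the parallel transport of `D` along the part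
`t ∈ s` of the curve `c` in `U` (up to the identification of `V` with a fiber of reference):
the covariant derivative along `c` of every smooth section is its ordinary derivative in the
frame `τ`, `D_{c'(t)} ψ = τ_t (d/dt) (τ_t⁻¹ ψ(c(t)))`. -/
def IsParallelTransport (D : VectorField m → Operator E) (U : Set (shell m))
    (c : ℝ → shell m) (s : Set ℝ) {V : Type*} [NormedAddCommGroup V] [InnerProductSpace ℂ V]
    (τ : ∀ t, V ≃ₗ[ℂ] E (c t)) : Prop :=
  ∀ t ∈ s, c t ∈ U ∧ ∃ v : R3, HasDerivAt (fun u => (c u : R3)) v t ∧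
    ∀ (X : VectorField m) (ψ : ∀ k, E k), SmoothField U X → SmoothSection F U ψ →
      (∀ a, X (c t) a = (v a : ℂ)) →
      HasDerivAt (fun u => (τ u).symm (ψ (c u))) ((τ t).symm (D X ψ (c t))) t

end Operators

end Particle

end

/-!
The rotation connection is an algebraic combination of derivatives of the group action on sections.
For a smooth family `γ` of Poincaré transformations with `γ 0 = 1`, let `L ψ k v` be the derivative
at `0`, in the direction `v`, of the transformed section `γ(w) ψ` evaluated at the fixed momentum
`k` (`ParticleBundle.lie`). It is read off in the fiber over `k`, so no connection is needed, and
smoothness of the action makes it a smooth section. It obeys a Leibniz rule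
`L (f ψ) v = f L ψ v - df(ξ v) ψ`, where `ξ v` is the velocity of `k` under the family
(`ParticleBundle.lie_smul`), and differentiating unitarity gives
`⟨L ψ v, ζ⟩ + ⟨ψ, L ζ v⟩ = -d⟨ψ, ζ⟩(ξ v)` (`ParticleBundle.inner_lie_add_inner_lie`).

Two families are used: rotations in the Cayley parametrization, with `ξ v = v × k`, and boosts
parametrized by `sinh η • n`, with `ξ v = ω v`. Both have three parameters and are smooth on all of
`ℝ³`, and every curve of rotations, respectively boosts along a fixed direction, factors through
them locally. Hence its derivative is a linear combination of the generators `J_a`, respectively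
`K_a`, although these are defined by one-parameter groups only. In these terms
`D_v ψ = |k|⁻² L_rot (v × k) - ⟨k, v⟩ / (ω |k|²) L_boost k - ⟨k, v⟩ / (2 ω²) ψ`
(`ParticleBundle.rotationComp_eq_covDeriv`), and the theorem follows:

* The Leibniz rule of `D` is the identity `(v × k) × k = ⟨k, v⟩ k - |k|² v`
  (`ParticleBundle.covDeriv_smul`).
* The two expressions for `D` differ by a commutator of `K` with a function of momentum, which is
  given by the divergence of `k k_a / (|k|² ω)` (`sum_fderiv_radialWeight`).
* For `v = Ω × k` with `Ω` orthogonal to `k`, the connection is `-L_rot Ω`; for `v = ω n` radial, it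
  is `-L_boost n - |k| / (2 ω)`. These are the derivatives of sections in frames transported by
  rotations and by normalized boosts (`ParticleBundle.isParallelTransport_rotation`,
  `ParticleBundle.isParallelTransport_boost`).
* `⟨D_v ψ, ζ⟩ + ⟨ψ, D_v ζ⟩ = ω d(⟨ψ, ζ⟩ / ω)(v)`, so that with the measure `d³k / ω` the failure of
  `D` to be anti-Hermitian is the integral of a partial derivative. The integral vanishes by Fubini,
  since almost every line parallel to a coordinate axis avoids the origin
  (`integral_fderiv_eq_zero`).
-/

noncomputable section

namespace Particle

/-! ### Functions on the momentum manifold -/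

section

variable {m : ℝ}

section Functions

variable {V : Type*} [NormedAddCommGroup V] [NormedSpace ℝ V]

/-- The extension by zero of a function on the momentum manifold to `ℝ³`. Since the manifold is open
in `ℝ³`, derivatives of the function are ordinary Fréchet derivatives of the extension. -/
def extendZero (f : shell m → V) : R3 → V := Function.extend Subtype.val f 0

omit [NormedSpace ℝ V] in
@[simp]
theorem extendZero_coe (f : shell m → V) (k : shell m) : extendZero f k = f k :=
  Subtype.val_injective.extend_apply f 0 k

theorem contDiffAt_extendZero {f : shell m → V} {k : shell m}
    (hf : ContMDiffAt 𝓘(ℝ, R3) 𝓘(ℝ, V) ∞ f k) : ContDiffAt ℝ ∞ (extendZero f) (k : R3) := by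
  rw [← contMDiffAt_iff_contDiffAt, ← contMDiffAt_subtype_iff]
  simpa using hf

theorem contMDiffAt_of_contDiffAt {f : R3 → V} {k : shell m}
    (hf : ContDiffAt ℝ ∞ f (k : R3)) :
    ContMDiffAt 𝓘(ℝ, R3) 𝓘(ℝ, V) ∞ (fun k : shell m => f k) k :=
  contMDiffAt_subtype_iff.mpr hf.contMDiffAt

theorem mvfderiv_eq_fderiv_extendZero {f : shell m → V} {k : shell m}
    (hf : ContMDiffAt 𝓘(ℝ, R3) 𝓘(ℝ, V) ∞ f k) (v : R3) :
    mvfderiv 𝓘(ℝ, R3) f k v = fderiv ℝ (extendZero f) (k : R3) v := by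
  have h := (hf.mdifferentiableAt (by simp)).mvfderiv
  rw [h]
  have h1 : writtenInExtChartAt 𝓘(ℝ, R3) 𝓘(ℝ, V) k f = f ∘ (chartAt R3 k).symm := by
    rfl
  have h2 : f ∘ (chartAt R3 k).symm =ᶠ[𝓝 (k : R3)] extendZero f := by
    have h3 := TopologicalSpace.Opens.chartAt_subtype_val_symm_eventuallyEq (shell m) (x := k)
      (H := R3)
    have h4 : (shell m : Set R3) ∈ 𝓝 (k : R3) := (shell m).isOpen.mem_nhds k.2
    filter_upwards [h3, h4] with x hx hx'
    have h5 : ((chartAt R3 k).symm x : R3) = x := hx.symm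
    rw [Function.comp_apply, ← extendZero_coe f, h5]
  rw [h1]
  simp only [modelWithCornersSelf_coe, Set.range_id, fderivWithin_univ]
  have h6 : extChartAt 𝓘(ℝ, R3) k k = (k : R3) := rfl
  rw [h6, h2.fderiv_eq]
  rfl

end Functions

end

/-! ### Smooth families of Poincaré transformations -/

section

variable {m : ℝ}

/-- A smooth three-parameter family of Poincaré transformations through the identity, symmetric in
the sense that opposite parameters give inverse transformations. Three parameters are needed to
read off the derivative in an arbitrary direction from those along the coordinate axes. -/
structure IsSmoothFamily (γ : R3 → Poincare) : Prop where
  contDiff : ∀ x : Spacetime, ContDiff ℝ ∞ fun w => (γ w).1 x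
  zero : γ 0 = 1
  neg : ∀ w, γ (-w) = (γ w)⁻¹

theorem energy_pos (k : shell m) : 0 < energy m k := k.2

theorem sq_add_norm_sq_pos (k : shell m) : 0 < m ^ 2 + ‖(k : R3)‖ ^ 2 := Real.sqrt_pos.mp k.2

theorem contDiffAt_energy (k : shell m) : ContDiffAt ℝ ∞ (energy m) (k : R3) := by
  unfold energy
  exact ((contDiff_const.add (contDiff_id.norm_sq ℝ)).contDiffAt).sqrt (sq_add_norm_sq_pos k).ne'

theorem hasFDerivAt_energy (k : shell m) :
    HasFDerivAt (energy m) ((energy m k)⁻¹ • innerSL ℝ (k : R3)) (k : R3) := by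
  unfold energy
  have h := (((hasFDerivAt_id (k : R3)).norm_sq).const_add (m ^ 2)).sqrt
    (sq_add_norm_sq_pos k).ne'
  refine h.congr_fderiv ?_
  ext v
  simp
  ring

/-- The velocity of the momentum `k` under a family of transformations, as a linear function of the
direction in the parameter space. -/
def velocity (γ : R3 → Poincare) (k : shell m) : R3 →L[ℝ] R3 :=
  fderiv ℝ (fun w => ((γ w • k : shell m) : R3)) 0

namespace IsSmoothFamily

variable {γ : R3 → Poincare} (hγ : IsSmoothFamily γ)
include hγ

/-- The linear parts are smooth too, being differences of values of the affine maps. -/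
theorem contDiff_linear (p : Spacetime) : ContDiff ℝ ∞ fun w => (γ w).1.linear p := by
  have h : (fun w => (γ w).1.linear p) = fun w => (γ w).1 p - (γ w).1 0 := by
    funext w
    have := (γ w).1.map_vadd 0 p
    simp only [vadd_eq_add, add_zero] at this
    rw [this, add_sub_cancel_right]
  rw [h]
  exact (hγ.contDiff p).sub (hγ.contDiff 0)

/-- The action on momenta is smooth jointly in the parameter and the momentum. -/
theorem contMDiff_smul :
    ContMDiff (𝓘(ℝ, R3).prod 𝓘(ℝ, R3)) 𝓘(ℝ, R3) ∞
      (fun p : R3 × shell m => γ p.1 • p.2) := by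
  rw [← ContMDiff.subtypeVal_comp_iff]
  have h : (Subtype.val ∘ fun p : R3 × shell m => γ p.1 • p.2) = fun p =>
      ((energy m p.2) • (γ p.1).1.linear (1, 0) +
        ∑ a, (p.2 : R3) a • (γ p.1).1.linear (0, EuclideanSpace.single a 1)).2 := by
    funext p
    have h1 : fourMomentum p.2 = (energy m p.2) • ((1, 0) : Spacetime) +
        ∑ a, (p.2 : R3) a • ((0, EuclideanSpace.single a 1) : Spacetime) := by
      refine Prod.ext ?_ ?_
      · simp [fourMomentum, Prod.fst_sum]
      · simp only [fourMomentum]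
        ext i
        fin_cases i <;> simp [Fin.sum_univ_three]
    change ((γ p.1).1.linear (fourMomentum p.2)).2 = _
    rw [h1, map_add, map_smul, map_sum]
    simp only [map_smul]
  rw [h]
  have hsnd : ContMDiff (𝓘(ℝ, R3).prod 𝓘(ℝ, R3)) 𝓘(ℝ, R3) ∞
      (fun p : R3 × shell m => (p.2 : R3)) := contMDiff_subtype_val.comp contMDiff_snd
  have hlin : ∀ q, ContMDiff (𝓘(ℝ, R3).prod 𝓘(ℝ, R3)) 𝓘(ℝ, R3) ∞
      (fun p : R3 × shell m => ((γ p.1).1.linear q).2) := fun q =>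
    ((contDiff_snd.comp (hγ.contDiff_linear q)).contMDiff).comp contMDiff_fst
  have hen : ContMDiff (𝓘(ℝ, R3).prod 𝓘(ℝ, R3)) 𝓘(ℝ, ℝ) ∞
      (fun p : R3 × shell m => energy m p.2) := fun p =>
    (contMDiffAt_of_contDiffAt (contDiffAt_energy p.2)).comp p contMDiffAt_snd
  have hco : ∀ a, ContMDiff (𝓘(ℝ, R3).prod 𝓘(ℝ, R3)) 𝓘(ℝ, ℝ) ∞
      (fun p : R3 × shell m => (p.2 : R3) a) := fun a =>
    ((EuclideanSpace.proj a : R3 →L[ℝ] ℝ).contDiff.contMDiff).comp hsnd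
  simp only [Prod.snd_add, Prod.smul_snd, Prod.snd_sum]
  exact (hen.smul (hlin _)).add (contMDiff_finsetSum fun a _ => (hco a).smul (hlin _))

theorem contMDiff_inv_smul :
    ContMDiff (𝓘(ℝ, R3).prod 𝓘(ℝ, R3)) 𝓘(ℝ, R3) ∞
      (fun p : R3 × shell m => (γ p.1)⁻¹ • p.2) := by
  simp only [← hγ.neg]
  exact hγ.contMDiff_smul.comp (contMDiff_fst.neg.prodMk contMDiff_snd)

theorem hasFDerivAt_smul (k : shell m) :
    HasFDerivAt (fun w => ((γ w • k : shell m) : R3)) (velocity γ k) 0 := by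
  have h1 : ContMDiff 𝓘(ℝ, R3) 𝓘(ℝ, R3) ∞ (fun w => ((γ w • k : shell m) : R3)) :=
    contMDiff_subtype_val.comp
      ((hγ.contMDiff_smul (m := m)).comp (contMDiff_id.prodMk contMDiff_const))
  exact (h1.contDiff.differentiable (by simp) 0).hasFDerivAt

/-- The inverse transformations, which enter the action on sections, move momenta with the opposite
velocity. -/
theorem hasFDerivAt_comp_inv_smul {V : Type*} [NormedAddCommGroup V] [NormedSpace ℝ V]
    {f : shell m → V} {k : shell m} (hf : ContMDiffAt 𝓘(ℝ, R3) 𝓘(ℝ, V) ∞ f k) :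
    HasFDerivAt (fun w => f ((γ w)⁻¹ • k))
      (-(fderiv ℝ (extendZero f) (k : R3) ∘L velocity γ k)) 0 := by
  have h1 : HasFDerivAt (fun w => (((γ w)⁻¹ • k : shell m) : R3)) (-velocity γ k) 0 := by
    have h2 : HasFDerivAt (fun w : R3 => -w) (-ContinuousLinearMap.id ℝ R3) 0 :=
      (hasFDerivAt_id (0 : R3)).neg
    have h3 := HasFDerivAt.comp (g := fun w => ((γ w • k : shell m) : R3)) (0 : R3)
      (by rw [neg_zero]; exact hγ.hasFDerivAt_smul k) h2
    simp only [Function.comp_def, hγ.neg] at h3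
    refine h3.congr_fderiv ?_
    ext; simp
  have h4 := ((contDiffAt_extendZero hf).differentiableAt (by simp)).hasFDerivAt
  have h5 := HasFDerivAt.comp (g := extendZero f) (0 : R3)
    (by rw [hγ.zero, inv_one, one_smul]; exact h4) h1
  simp only [Function.comp_def, extendZero_coe] at h5
  refine h5.congr_fderiv ?_
  ext; simp

end IsSmoothFamily

end

/-! ### The infinitesimal action on sections -/

section

variable {m : ℝ}

section Alg
variable {F : Type*} [NormedAddCommGroup F] [NormedSpace ℂ F]
  {E : shell m → Type*} [TopologicalSpace (TotalSpace F E)]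
  [∀ k, NormedAddCommGroup (E k)] [∀ k, InnerProductSpace ℂ (E k)] [FiberBundle F E]

omit [∀ k, InnerProductSpace ℂ (E k)] in
theorem fiberCast_add {k k' : shell m} (h : k = k') (v w : E k) :
    fiberCast h (v + w) = fiberCast h v + fiberCast h w := by
  subst h; rfl

theorem fiberCast_smul {k k' : shell m} (h : k = k') (c : ℂ) (v : E k) :
    fiberCast h (c • v) = c • fiberCast h v := by
  subst h; rfl

theorem inner_fiberCast {k k' : shell m} (h : k = k') (v w : E k) :
    inner ℂ (fiberCast h v) (fiberCast h w) = inner ℂ v w := by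
  subst h; rfl

omit [∀ k, NormedAddCommGroup (E k)] [∀ k, InnerProductSpace ℂ (E k)]
  [NormedAddCommGroup F] [NormedSpace ℂ F] [FiberBundle F E]
  [TopologicalSpace (TotalSpace F E)] in
theorem mk_fiberCast {k k' : shell m} (h : k = k') (v : E k) :
    (⟨k', fiberCast h v⟩ : TotalSpace F E) = ⟨k, v⟩ := by
  subst h; rfl

namespace ParticleBundle

variable (B : ParticleBundle F E)

/-- The action of the Poincaré group on the total space. Working in the total space avoids
comparing fibers over points that agree only propositionally. -/
def totalAct (g : Poincare) (p : TotalSpace F E) : TotalSpace F E := ⟨g • p.1, B.act g p.1 p.2⟩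

theorem totalAct_one (p : TotalSpace F E) : B.totalAct 1 p = p := B.act_one p.1 p.2

theorem totalAct_mul (g h : Poincare) (p : TotalSpace F E) :
    B.totalAct (g * h) p = B.totalAct g (B.totalAct h p) := B.act_mul g h p.1 p.2

theorem mk_actSection (g : Poincare) (ψ : ∀ k, E k) (k : shell m) :
    (⟨k, B.actSection g ψ k⟩ : TotalSpace F E) = B.totalAct g ⟨g⁻¹ • k, ψ (g⁻¹ • k)⟩ :=
  mk_fiberCast _ _

theorem actSection_one (ψ : ∀ k, E k) (k : shell m) : B.actSection 1 ψ k = ψ k := by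
  have h := B.mk_actSection 1 ψ k
  rw [totalAct_one] at h
  have h2 : (⟨(1 : Poincare)⁻¹ • k, ψ ((1 : Poincare)⁻¹ • k)⟩ : TotalSpace F E) = ⟨k, ψ k⟩ := by
    rw [inv_one, one_smul]
  rw [h2] at h
  exact TotalSpace.mk_injective k h

theorem actSection_add (g : Poincare) (ψ ζ : ∀ k, E k) (k : shell m) :
    B.actSection g (ψ + ζ) k = B.actSection g ψ k + B.actSection g ζ k := by
  simp only [actSection, Pi.add_apply, map_add, fiberCast_add]

theorem actSection_smul (g : Poincare) (f : shell m → ℂ) (ψ : ∀ k, E k) (k : shell m) :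
    B.actSection g (fun k => f k • ψ k) k = f (g⁻¹ • k) • B.actSection g ψ k := by
  simp only [actSection, map_smul, fiberCast_smul]

theorem inner_actSection (g : Poincare) (ψ ζ : ∀ k, E k) (k : shell m) :
    inner ℂ (B.actSection g ψ k) (B.actSection g ζ k) =
      inner ℂ (ψ (g⁻¹ • k)) (ζ (g⁻¹ • k)) := by
  simp only [actSection, inner_fiberCast, LinearIsometryEquiv.inner_map_map]

theorem actSection_congr (g : Poincare) {ψ ζ : ∀ k, E k} {k : shell m}
    (h : ψ (g⁻¹ • k) = ζ (g⁻¹ • k)) : B.actSection g ψ k = B.actSection g ζ k := by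
  simp only [actSection, h]

/-- Pulling the values of a section along an orbit back to the fiber at `k` amounts to transforming
the section and evaluating it at the fixed point `h k` of the orbit. This reduces derivatives along
the orbit to derivatives of the action on sections. -/
theorem act_symm_eq_actSection (g h : Poincare) (ψ : ∀ k, E k) (k : shell m) :
    (B.act g k).symm (ψ (g • k)) = (B.act h k).symm (B.actSection (h * g⁻¹) ψ (h • k)) := by
  rw [LinearIsometryEquiv.eq_symm_apply]
  set w := (B.act g k).symm (ψ (g • k)) with hw
  have hw' : ψ (g • k) = B.act g k w := by rw [hw, LinearIsometryEquiv.apply_symm_apply]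
  refine TotalSpace.mk_injective (F := F) (h • k) ?_
  have h1 := B.mk_actSection (h * g⁻¹) ψ (h • k)
  have h2 : (h * g⁻¹)⁻¹ • h • k = g • k := by rw [smul_smul]; simp
  have h3 : (⟨(h * g⁻¹)⁻¹ • h • k, ψ ((h * g⁻¹)⁻¹ • h • k)⟩ : TotalSpace F E) =
      B.totalAct g ⟨k, w⟩ := by
    rw [h2, hw']; rfl
  rw [h3, ← totalAct_mul, inv_mul_cancel_right] at h1
  exact h1.symm

end ParticleBundle
end Alg

section Smooth

variable {F : Type*} [NormedAddCommGroup F] [NormedSpace ℂ F]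
  {E : shell m → Type*} [TopologicalSpace (TotalSpace F E)]
  [∀ k, NormedAddCommGroup (E k)] [∀ k, InnerProductSpace ℂ (E k)]
  [FiberBundle F E]

omit [∀ k, InnerProductSpace ℂ (E k)] in
/-- Over an open set, smoothness of a section is smoothness in the local trivializations. -/
theorem smoothSection_iff {U : Set (shell m)} (hU : IsOpen U) {ψ : ∀ k, E k} :
    SmoothSection F U ψ ↔ ∀ k₀ ∈ U, ContMDiffAt 𝓘(ℝ, R3) 𝓘(ℝ, F) ∞
      (fun k => (trivializationAt F E k₀ ⟨k, ψ k⟩).2) k₀ := by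
  refine forall₂_congr fun k hk => ?_
  rw [contMDiffWithinAt_section]
  exact ⟨fun h => h.contMDiffAt (hU.mem_nhds hk), fun h => h.contMDiffWithinAt⟩

namespace SmoothSection

variable {U : Set (shell m)} {ψ ζ : ∀ k, E k}

theorem add [VectorBundle ℂ F E] (hU : IsOpen U) (hψ : SmoothSection F U ψ)
    (hζ : SmoothSection F U ζ) :
    SmoothSection F U (fun k => ψ k + ζ k) := by
  rw [smoothSection_iff hU] at *
  intro k₀ hk₀
  refine ((hψ k₀ hk₀).add (hζ k₀ hk₀)).congr_of_eventuallyEq ?_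
  filter_upwards [(trivializationAt F E k₀).open_baseSet.mem_nhds
    (mem_baseSet_trivializationAt F E k₀)] with k hk
  exact ((trivializationAt F E k₀).linear ℂ hk).map_add _ _

theorem smul [VectorBundle ℂ F E] (hU : IsOpen U) {f : shell m → ℂ}
    (hf : ContMDiffOn 𝓘(ℝ, R3) 𝓘(ℝ, ℂ) ∞ f U) (hψ : SmoothSection F U ψ) :
    SmoothSection F U (fun k => f k • ψ k) := by
  rw [smoothSection_iff hU] at *
  intro k₀ hk₀
  have h1 := (hf k₀ hk₀).contMDiffAt (hU.mem_nhds hk₀)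
  have h2 : ContMDiffAt 𝓘(ℝ, R3) 𝓘(ℝ, F) ∞
      (fun k => f k • (trivializationAt F E k₀ ⟨k, ψ k⟩).2) k₀ := by
    have h3 : ContDiff ℝ ∞ (fun p : ℂ × F => p.1 • p.2) := contDiff_fst.smul contDiff_snd
    exact h3.contMDiff.contMDiffAt.comp k₀ (h1.prodMk_space (hψ k₀ hk₀))
  refine h2.congr_of_eventuallyEq ?_
  filter_upwards [(trivializationAt F E k₀).open_baseSet.mem_nhds
    (mem_baseSet_trivializationAt F E k₀)] with k hk
  exact ((trivializationAt F E k₀).linear ℂ hk).map_smul _ _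

end SmoothSection

namespace ParticleBundle

variable (B : ParticleBundle F E) {γ : R3 → Poincare} (hγ : IsSmoothFamily γ)

/-- The derivative at the origin of the action of a family of Poincaré transformations on a section,
at a fixed momentum, as a linear function of the direction in the parameter space. -/
def lie (γ : R3 → Poincare) (ψ : ∀ k, E k) (k : shell m) : R3 →L[ℝ] E k :=
  fderiv ℝ (fun w => B.actSection (γ w) ψ k) 0

variable {U : Set (shell m)} {ψ ζ : ∀ k, E k} {k k₀ : shell m}

include hγ

/-- In a local trivialization, the transformed section is smooth jointly in the momentum and the
parameter of the transformation. -/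
theorem contMDiffAt_actSection (hU : IsOpen U) (hψ : SmoothSection F U ψ) (hk₀ : k₀ ∈ U) :
    ContMDiffAt (𝓘(ℝ, R3).prod 𝓘(ℝ, R3)) 𝓘(ℝ, F) ∞
      (fun p : shell m × R3 => (trivializationAt F E k₀ ⟨p.1, B.actSection (γ p.2) ψ p.1⟩).2)
      (k₀, 0) := by
  have hinv := hγ.contMDiff_inv_smul (m := m)
  have h0 : (γ 0)⁻¹ • k₀ = k₀ := by rw [hγ.zero, inv_one, one_smul]
  have h1 : ContMDiffAt (𝓘(ℝ, R3).prod 𝓘(ℝ, R3)) 𝓘(ℝ, R3) ∞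
      (fun p : shell m × R3 => (γ p.2)⁻¹ • p.1) (k₀, 0) :=
    (hinv.comp (contMDiff_snd.prodMk contMDiff_fst)).contMDiffAt
  have h2 : ContMDiffAt (𝓘(ℝ, R3).prod 𝓘(ℝ, R3)) (𝓘(ℝ, R3).prod 𝓘(ℝ, F)) ∞
      (fun p : shell m × R3 => (⟨(γ p.2)⁻¹ • p.1, ψ ((γ p.2)⁻¹ • p.1)⟩ : TotalSpace F E))
      (k₀, 0) := by
    have h3 : ContMDiffAt 𝓘(ℝ, R3) (𝓘(ℝ, R3).prod 𝓘(ℝ, F)) ∞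
        (fun k => (⟨k, ψ k⟩ : TotalSpace F E)) k₀ := (hψ k₀ hk₀).contMDiffAt (hU.mem_nhds hk₀)
    exact ContMDiffAt.comp_of_eq (g := fun k => (⟨k, ψ k⟩ : TotalSpace F E)) h3 h1 h0
  have h4 : ContMDiffAt (𝓘(ℝ, R3).prod 𝓘(ℝ, R3)) (𝓘(ℝ, R3).prod 𝓘(ℝ, F)) ∞
      (fun p : shell m × R3 => (⟨p.1, B.actSection (γ p.2) ψ p.1⟩ : TotalSpace F E)) (k₀, 0) := by
    have h5 := (B.smooth_act 3 γ hγ.contDiff).contMDiffAt.comp _ (contMDiffAt_snd.prodMk h2)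
    refine h5.congr_of_eventuallyEq (Filter.Eventually.of_forall fun p => ?_)
    exact B.mk_actSection _ _ _
  have h6 := (contMDiffAt_totalSpace.mp h4).2
  exact h6

theorem eventually_actSection_eq (hU : IsOpen U) (hk : k ∈ U) (h : ∀ k ∈ U, ψ k = ζ k) :
    ∀ᶠ w in 𝓝 0, B.actSection (γ w) ψ k = B.actSection (γ w) ζ k := by
  have h1 : Continuous fun w => (γ w)⁻¹ • k :=
    (hγ.contMDiff_inv_smul (m := m)).continuous.comp (by fun_prop : Continuous fun w => (w, k))
  have h2 := h1.continuousAt (x := 0) |>.preimage_mem_nhds (t := U)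
    (by rw [hγ.zero, inv_one, one_smul]; exact hU.mem_nhds hk)
  filter_upwards [h2] with w hw
  exact B.actSection_congr _ (h _ hw)

theorem lie_congr (hU : IsOpen U) (hk : k ∈ U) (h : ∀ k ∈ U, ψ k = ζ k) :
    B.lie γ ψ k = B.lie γ ζ k :=
  Filter.EventuallyEq.fderiv_eq (B.eventually_actSection_eq hγ hU hk h)

variable [VectorBundle ℝ F E]

theorem contDiffAt_actSection (hU : IsOpen U) (hψ : SmoothSection F U ψ) (hk : k ∈ U) :
    ContDiffAt ℝ ∞ (fun w => B.actSection (γ w) ψ k) 0 := by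
  have h1 := B.contMDiffAt_actSection hγ hU hψ hk
  have h2 : ContMDiffAt 𝓘(ℝ, R3) 𝓘(ℝ, F) ∞
      (fun w : R3 => (trivializationAt F E k ⟨k, B.actSection (γ w) ψ k⟩).2) 0 :=
    h1.comp (0 : R3) (contMDiffAt_const.prodMk contMDiffAt_id)
  rw [contMDiffAt_iff_contDiffAt] at h2
  set e := (trivializationAt F E k).continuousLinearEquivAt ℝ k
    (mem_baseSet_trivializationAt F E k)
  have h3 := e.symm.contDiff.contDiffAt.comp (0 : R3) h2
  refine h3.congr_of_eventuallyEq (Filter.Eventually.of_forall fun w => ?_)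
  exact (e.symm_apply_apply _).symm

theorem hasFDerivAt_actSection (hU : IsOpen U) (hψ : SmoothSection F U ψ) (hk : k ∈ U) :
    HasFDerivAt (fun w => B.actSection (γ w) ψ k) (B.lie γ ψ k) 0 :=
  ((B.contDiffAt_actSection hγ hU hψ hk).differentiableAt (by simp)).hasFDerivAt

/-- The derivative along a family of transformations is again a smooth section: in a local
trivialization it is a partial derivative of a jointly smooth function. -/
theorem smoothSection_lie (hU : IsOpen U) (hψ : SmoothSection F U ψ) (v : R3) :
    SmoothSection F U (fun k => B.lie γ ψ k v) := by
  rw [smoothSection_iff hU]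
  intro k₀ hk₀
  have h1 := (B.contMDiffAt_actSection hγ hU hψ hk₀).mfderiv_apply
    (fun k w => (trivializationAt F E k₀ ⟨k, B.actSection (γ w) ψ k⟩).2) (fun _ => (0 : R3))
    id (fun _ => v) (x₀ := k₀) (m := ∞) contMDiffAt_const contMDiffAt_id contMDiffAt_const (by simp)
  refine h1.congr_of_eventuallyEq ?_
  filter_upwards [(trivializationAt F E k₀).open_baseSet.mem_nhds
    (mem_baseSet_trivializationAt F E k₀), hU.mem_nhds hk₀] with k hk hkU
  set e := (trivializationAt F E k₀).continuousLinearEquivAt ℝ k hk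
  have h2 := (e.hasFDerivAt.comp (0 : R3) (B.hasFDerivAt_actSection hγ hU hψ hkU)).fderiv
  have h3 := congrArg (fun L => L v) h2
  refine h3.symm.trans ?_
  rw [← mfderiv_eq_fderiv]
  exact (DFunLike.congr_fun (congrFun (inTangentCoordinates_model_space (I := 𝓘(ℝ, R3))
    (I' := 𝓘(ℝ, F)) (fun _ : shell m => (0 : R3))
    (fun k => (trivializationAt F E k₀ ⟨k, B.actSection (γ 0) ψ k⟩).2)
    (fun k => mfderiv 𝓘(ℝ, R3) 𝓘(ℝ, F)
      (fun w => (trivializationAt F E k₀ ⟨k, B.actSection (γ w) ψ k⟩).2) 0) k₀) k) v).symm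

/-- The Leibniz rule: on functions, a family of transformations acts by its velocity field, with a
minus sign from `(g f)(k) = f (g⁻¹ k)`. -/
theorem lie_smul (hU : IsOpen U) (hψ : SmoothSection F U ψ) (hk : k ∈ U) {f : shell m → ℂ}
    (hf : ContMDiffAt 𝓘(ℝ, R3) 𝓘(ℝ, ℂ) ∞ f k) (v : R3) :
    B.lie γ (fun k => f k • ψ k) k v =
      f k • B.lie γ ψ k v - fderiv ℝ (extendZero f) (k : R3) (velocity γ k v) • ψ k := by
  have h1 := (hγ.hasFDerivAt_comp_inv_smul hf).smul (B.hasFDerivAt_actSection hγ hU hψ hk)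
  have h2 : (fun w => B.actSection (γ w) (fun k => f k • ψ k) k) =
      (fun w => f ((γ w)⁻¹ • k)) • fun w => B.actSection (γ w) ψ k := by
    funext w; exact B.actSection_smul _ _ _ _
  rw [lie, h2, h1.fderiv]
  simp [hγ.zero, actSection_one, sub_eq_add_neg]

theorem lie_add (hU : IsOpen U) (hψ : SmoothSection F U ψ) (hζ : SmoothSection F U ζ)
    (hk : k ∈ U) : B.lie γ (ψ + ζ) k = B.lie γ ψ k + B.lie γ ζ k := by
  have h2 : (fun w => B.actSection (γ w) (ψ + ζ) k) =
      (fun w => B.actSection (γ w) ψ k) + fun w => B.actSection (γ w) ζ k := by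
    funext w; exact B.actSection_add _ _ _ _
  rw [lie, h2, ((B.hasFDerivAt_actSection hγ hU hψ hk).add
    (B.hasFDerivAt_actSection hγ hU hζ hk)).fderiv]

/-- Unitarity of the action, differentiated. -/
theorem inner_lie_add_inner_lie (hU : IsOpen U) (hψ : SmoothSection F U ψ)
    (hζ : SmoothSection F U ζ) (hk : k ∈ U) (v : R3) :
    inner ℂ (B.lie γ ψ k v) (ζ k) + inner ℂ (ψ k) (B.lie γ ζ k v) =
      -fderiv ℝ (extendZero fun k => inner ℂ (ψ k) (ζ k)) (k : R3) (velocity γ k v) := by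
  have h1 := (B.hasFDerivAt_actSection hγ hU hψ hk).inner ℂ
    (B.hasFDerivAt_actSection hγ hU hζ hk)
  have h2 := (B.smooth_inner U hU ψ ζ hψ hζ).contMDiffAt (hU.mem_nhds hk)
  have h3 := hγ.hasFDerivAt_comp_inv_smul h2
  simp only [inner_actSection] at h1
  have h4 := DFunLike.congr_fun (h1.unique h3) v
  simp only [hγ.zero, actSection_one] at h4
  rw [add_comm]
  simpa using h4

end ParticleBundle
end Smooth

end

/-! ### Rotations in the Cayley parametrization -/

section

variable {m : ℝ}

/-- The numerator of the Cayley parametrization of rotations: the matrix of the conjugation by the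
quaternion `2 + w`. -/
def cayleyNum (w : R3) : Matrix (Fin 3) (Fin 3) ℝ :=
  !![4 + w 0 ^ 2 - w 1 ^ 2 - w 2 ^ 2, 2 * w 0 * w 1 - 4 * w 2, 2 * w 0 * w 2 + 4 * w 1;
    2 * w 0 * w 1 + 4 * w 2, 4 - w 0 ^ 2 + w 1 ^ 2 - w 2 ^ 2, 2 * w 1 * w 2 - 4 * w 0;
    2 * w 0 * w 2 - 4 * w 1, 2 * w 1 * w 2 + 4 * w 0, 4 - w 0 ^ 2 - w 1 ^ 2 + w 2 ^ 2]

/-- The squared norm of the quaternion `2 + w`. -/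
def cayleyDen (w : R3) : ℝ := 4 + w 0 ^ 2 + w 1 ^ 2 + w 2 ^ 2

theorem cayleyDen_pos (w : R3) : 0 < cayleyDen w := by unfold cayleyDen; positivity

theorem cayleyNum_mul_transpose (w : R3) :
    cayleyNum w * (cayleyNum w).transpose = (cayleyDen w ^ 2) • 1 := by
  ext i j
  fin_cases i <;> fin_cases j <;>
    simp [cayleyNum, cayleyDen, Matrix.mul_apply, Fin.sum_univ_three] <;> ring

theorem det_cayleyNum (w : R3) : (cayleyNum w).det = cayleyDen w ^ 3 := by
  simp [cayleyNum, cayleyDen, Matrix.det_fin_three]; ring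

/-- The Cayley parametrization of the rotations `x ↦ x + w × x + O(w²)`: the conjugation by the unit
quaternion proportional to `2 + w`. It is rational, defined for all `w`, and covers the rotations
by angles less than `π`. -/
def cayley (w : R3) : SO3 :=
  ⟨(cayleyDen w)⁻¹ • cayleyNum w, by
    have h := (cayleyDen_pos w).ne'
    rw [Matrix.mem_specialOrthogonalGroup_iff, Matrix.mem_orthogonalGroup_iff]
    constructor
    · change ((cayleyDen w)⁻¹ • cayleyNum w) * ((cayleyDen w)⁻¹ • cayleyNum w).transpose = 1
      rw [Matrix.transpose_smul, Matrix.smul_mul, Matrix.mul_smul, cayleyNum_mul_transpose,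
        smul_smul, smul_smul]
      have : (cayleyDen w)⁻¹ * (cayleyDen w)⁻¹ * cayleyDen w ^ 2 = 1 := by field_simp
      rw [this, one_smul]
    · rw [Matrix.det_smul, det_cayleyNum, Fintype.card_fin]
      field_simp⟩

theorem coe_cayley (w : R3) :
    (cayley w : Matrix (Fin 3) (Fin 3) ℝ) = (cayleyDen w)⁻¹ • cayleyNum w := rfl

theorem cayley_zero : cayley 0 = 1 := by
  refine Subtype.ext ?_
  ext i j
  fin_cases i <;> fin_cases j <;> simp [coe_cayley, cayleyNum, cayleyDen]

theorem cayley_neg (w : R3) : cayley (-w) = (cayley w)⁻¹ := by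
  refine Subtype.ext ?_
  change _ = (cayley w : Matrix (Fin 3) (Fin 3) ℝ).transpose
  have h1 : cayleyDen (-w) = cayleyDen w := by simp [cayleyDen]
  have h2 : cayleyNum (-w) = (cayleyNum w).transpose := by
    ext i j
    fin_cases i <;> fin_cases j <;> simp [cayleyNum] <;> ring
  rw [coe_cayley, coe_cayley, h1, h2, Matrix.transpose_smul]

/-- The parameter `w` of a rotation matrix in the Cayley parametrization: twice the axial vector of
`M - Mᵀ`, divided by `1 + tr M`. -/
def cayleyCoord (M : Matrix (Fin 3) (Fin 3) ℝ) : R3 :=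
  !₂[2 * (M 2 1 - M 1 2) / (1 + M.trace), 2 * (M 0 2 - M 2 0) / (1 + M.trace),
    2 * (M 1 0 - M 0 1) / (1 + M.trace)]

/-- The cofactors of a rotation matrix are its entries. -/
theorem adjugate_eq_transpose (M : SO3) :
    (M : Matrix (Fin 3) (Fin 3) ℝ).adjugate = (M : Matrix (Fin 3) (Fin 3) ℝ).transpose := by
  have h := Matrix.mem_specialOrthogonalGroup_iff.mp M.2
  have h1 : (M : Matrix (Fin 3) (Fin 3) ℝ).transpose * M.1 = 1 :=
    (Matrix.mem_orthogonalGroup_iff' _ _).mp h.1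
  calc (M : Matrix (Fin 3) (Fin 3) ℝ).adjugate
      = ((M : Matrix (Fin 3) (Fin 3) ℝ).transpose * M.1) * M.1.adjugate := by rw [h1, one_mul]
    _ = _ := by rw [mul_assoc, Matrix.mul_adjugate, h.2, one_smul, mul_one]

/-- Every rotation with `1 + tr M ≠ 0`, that is, by an angle other than `π`, is given by its Cayley
parameter. -/
theorem cayley_cayleyCoord (M : SO3) (h : 1 + (M : Matrix (Fin 3) (Fin 3) ℝ).trace ≠ 0) :
    cayley (cayleyCoord M) = M := by
  have ho : (M : Matrix (Fin 3) (Fin 3) ℝ) * M.1.transpose = 1 :=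
    (Matrix.mem_orthogonalGroup_iff _ _).mp (Matrix.mem_specialOrthogonalGroup_iff.mp M.2).1
  have ho' : (M : Matrix (Fin 3) (Fin 3) ℝ).transpose * M.1 = 1 :=
    (Matrix.mem_orthogonalGroup_iff' _ _).mp (Matrix.mem_specialOrthogonalGroup_iff.mp M.2).1
  have ha := adjugate_eq_transpose M
  refine Subtype.ext ?_
  rw [coe_cayley]
  generalize (M : Matrix (Fin 3) (Fin 3) ℝ) = A at *
  rw [Matrix.adjugate_fin_three] at ha
  -- `c`: entries are cofactors; `r`, `l`: rows and columns are orthonormal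
  have hc : ∀ i j, _ := fun i j => congrFun (congrFun ha i) j
  have hr : ∀ i j, _ := fun i j => congrFun (congrFun ho i) j
  have hl : ∀ i j, _ := fun i j => congrFun (congrFun ho' i) j
  have c00 := hc 0 0
  have c01 := hc 0 1
  have c02 := hc 0 2
  have c10 := hc 1 0
  have c11 := hc 1 1
  have c12 := hc 1 2
  have c20 := hc 2 0
  have c21 := hc 2 1
  have c22 := hc 2 2
  have r00 := hr 0 0
  have r11 := hr 1 1
  have r22 := hr 2 2
  have r01 := hr 0 1
  have r02 := hr 0 2
  have r12 := hr 1 2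
  have l00 := hl 0 0
  have l11 := hl 1 1
  have l22 := hl 2 2
  have l01 := hl 0 1
  have l02 := hl 0 2
  have l12 := hl 1 2
  clear hc hr hl ha ho ho'
  simp at c00 c01 c02 c10 c11 c12 c20 c21 c22
  simp [Matrix.mul_apply, Fin.sum_univ_three] at r00 r11 r22 r01 r02 r12 l00 l11 l22 l01 l02 l12
  obtain ⟨T, hT⟩ : ∃ T, T = 1 + A.trace := ⟨_, rfl⟩
  obtain ⟨v0, hv0⟩ : ∃ v, v = A 2 1 - A 1 2 := ⟨_, rfl⟩
  obtain ⟨v1, hv1⟩ : ∃ v, v = A 0 2 - A 2 0 := ⟨_, rfl⟩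
  obtain ⟨v2, hv2⟩ : ∃ v, v = A 1 0 - A 0 1 := ⟨_, rfl⟩
  obtain ⟨w, hw⟩ : ∃ w, w = cayleyCoord A := ⟨_, rfl⟩
  have hw0 : w 0 = 2 * v0 / T := by simp [hw, cayleyCoord, hT, hv0]
  have hw1 : w 1 = 2 * v1 / T := by simp [hw, cayleyCoord, hT, hv1]
  have hw2 : w 2 = 2 * v2 / T := by simp [hw, cayleyCoord, hT, hv2]
  rw [← hw]
  rw [← hT] at h
  rw [Matrix.trace_fin_three] at hT
  have hd : T ^ 2 + v0 ^ 2 + v1 ^ 2 + v2 ^ 2 = 4 * T := by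
    rw [hT, hv0, hv1, hv2]
    linear_combination r00 + r11 + r22 + 2 * c00 + 2 * c11 + 2 * c22
  have d0 : v1 ^ 2 + v2 ^ 2 = 2 * (1 - A 0 0) * T := by
    rw [hT, hv1, hv2]
    linear_combination r00 + l00 + 2 * c11 + 2 * c22
  have d1 : v0 ^ 2 + v2 ^ 2 = 2 * (1 - A 1 1) * T := by
    rw [hT, hv0, hv2]
    linear_combination r11 + l11 + 2 * c00 + 2 * c22
  have d2 : v0 ^ 2 + v1 ^ 2 = 2 * (1 - A 2 2) * T := by
    rw [hT, hv0, hv1]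
    linear_combination r22 + l22 + 2 * c00 + 2 * c11
  have e01 : v0 * v1 = (A 0 1 + A 1 0) * T := by
    rw [hT, hv0, hv1]
    linear_combination c01 + c10 - l01 - r01
  have e02 : v0 * v2 = (A 0 2 + A 2 0) * T := by
    rw [hT, hv0, hv2]
    linear_combination c02 + c20 - l02 - r02
  have e12 : v1 * v2 = (A 1 2 + A 2 1) * T := by
    rw [hT, hv1, hv2]
    linear_combination c12 + c21 - l12 - r12
  have hden : cayleyDen w = 16 / T := by
    rw [cayleyDen, hw0, hw1, hw2]
    field_simp
    linear_combination 4 * hd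
  rw [hden]
  ext i j
  fin_cases i <;> fin_cases j <;> simp [cayleyNum, hw0, hw1, hw2] <;> field_simp
  · linear_combination 4 * hd - 8 * d0
  · linear_combination 8 * e01 - 8 * T * hv2
  · linear_combination 8 * e02 + 8 * T * hv1
  · linear_combination 8 * e01 + 8 * T * hv2
  · linear_combination 4 * hd - 8 * d1
  · linear_combination 8 * e12 - 8 * T * hv0
  · linear_combination 8 * e02 - 8 * T * hv1
  · linear_combination 8 * e12 + 8 * T * hv0
  · linear_combination 4 * hd - 8 * d2

/-- The rotations in the Cayley parametrization, as Poincaré transformations. -/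
def rotFamily (w : R3) : Poincare := rotation (cayley w)

theorem rotation_apply (R : SO3) (x : Spacetime) :
    (rotation R).1 x = (x.1, Matrix.toEuclideanLin (R : Matrix (Fin 3) (Fin 3) ℝ) x.2) := rfl

theorem coe_rotation_smul (R : SO3) (k : shell m) :
    ((rotation R • k : shell m) : R3) =
      Matrix.toEuclideanLin (R : Matrix (Fin 3) (Fin 3) ℝ) k := rfl

theorem rotation_one : rotation 1 = 1 := by
  refine Subtype.ext (AffineEquiv.ext fun x => ?_)
  change (rotation 1).1 x = x
  rw [rotation_apply]
  simp

theorem rotation_mul (R S : SO3) : rotation (R * S) = rotation R * rotation S := by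
  refine Subtype.ext (AffineEquiv.ext fun x => ?_)
  change (rotation (R * S)).1 x = (rotation R).1 ((rotation S).1 x)
  simp [rotation_apply, Matrix.toLpLin_apply, Matrix.mulVec_mulVec]

theorem rotation_inv (R : SO3) : rotation R⁻¹ = (rotation R)⁻¹ := by
  rw [eq_inv_iff_mul_eq_one, ← rotation_mul, inv_mul_cancel, rotation_one]

theorem toEuclideanLin_cayley (w x : R3) :
    Matrix.toEuclideanLin (cayley w : Matrix (Fin 3) (Fin 3) ℝ) x =
      x + (cayleyDen w)⁻¹ • ((4 : ℝ) • cross w x + (2 : ℝ) • cross w (cross w x)) := by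
  have h := (cayleyDen_pos w).ne'
  ext i
  fin_cases i <;>
    simp [coe_cayley, cayleyNum, Matrix.toLpLin_apply, cross, crossProduct,
      dotProduct, Fin.sum_univ_three] <;> field_simp <;> simp only [cayleyDen] <;> ring

theorem contDiff_cross {n : ℕ∞ω} {X : Type*} [NormedAddCommGroup X] [NormedSpace ℝ X]
    {f g : X → R3} (hf : ContDiff ℝ n f) (hg : ContDiff ℝ n g) :
    ContDiff ℝ n fun x => cross (f x) (g x) := by
  have hf' := contDiff_euclidean.mp hf
  have hg' := contDiff_euclidean.mp hg
  rw [contDiff_euclidean]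
  intro i
  fin_cases i <;> simp only [cross, crossProduct] <;> simp <;>
    exact ((hf' _).mul (hg' _)).sub ((hf' _).mul (hg' _))

theorem isSmoothFamily_rotFamily : IsSmoothFamily rotFamily where
  contDiff x := by
    have h : ContDiff ℝ ∞ fun w : R3 => (cayleyDen w)⁻¹ := by
      refine ContDiff.inv ?_ fun w => (cayleyDen_pos w).ne'
      unfold cayleyDen
      have hc := contDiff_euclidean.mp (contDiff_id (𝕜 := ℝ) (n := ∞) (E := R3))
      exact ((contDiff_const.add ((hc 0).pow 2)).add ((hc 1).pow 2)).add ((hc 2).pow 2)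
    simp only [rotFamily, rotation_apply, toEuclideanLin_cayley]
    have h1 : ContDiff ℝ ∞ fun w : R3 => cross w x.2 := contDiff_cross contDiff_id contDiff_const
    exact contDiff_const.prodMk (contDiff_const.add (h.smul
      ((h1.const_smul (4 : ℝ)).add ((contDiff_cross contDiff_id h1).const_smul (2 : ℝ)))))
  zero := by rw [rotFamily, cayley_zero, rotation_one]
  neg w := by rw [rotFamily, cayley_neg, rotation_inv, rotFamily]

theorem cross_smul_left (c : ℝ) (x y : R3) : cross (c • x) y = c • cross x y := by
  simp [cross]

theorem cross_smul_right (c : ℝ) (x y : R3) : cross x (c • y) = c • cross x y := by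
  simp [cross]

theorem velocity_eq_of_hasDerivAt {γ : R3 → Poincare} (hγ : IsSmoothFamily γ) {k : shell m}
    {v u : R3} (h : HasDerivAt (fun t : ℝ => ((γ (t • v) • k : shell m) : R3)) u 0) :
    velocity γ k v = u := by
  have h1 : HasDerivAt (fun t : ℝ => t • v) v 0 := by
    simpa using (hasDerivAt_id (0 : ℝ)).smul_const v
  have h2 := HasFDerivAt.comp_hasDerivAt (l := fun w => ((γ w • k : shell m) : R3)) (0 : ℝ)
    (by rw [zero_smul]; exact hγ.hasFDerivAt_smul k) h1
  exact h2.unique h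

theorem velocity_rotFamily (k : shell m) (v : R3) : velocity rotFamily k v = cross v k := by
  refine velocity_eq_of_hasDerivAt isSmoothFamily_rotFamily ?_
  simp only [rotFamily, coe_rotation_smul, toEuclideanLin_cayley]
  have h1 : ∀ t : ℝ, cayleyDen (t • v) = 4 + t ^ 2 * (v 0 ^ 2 + v 1 ^ 2 + v 2 ^ 2) := by
    intro t; simp [cayleyDen]; ring
  simp only [h1, cross_smul_left, cross_smul_right]
  have h2 : HasDerivAt (fun t : ℝ => (4 + t ^ 2 * (v 0 ^ 2 + v 1 ^ 2 + v 2 ^ 2))⁻¹) 0 0 := by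
    have h3 := (((hasDerivAt_id (0 : ℝ)).pow 2).mul_const
      (v 0 ^ 2 + v 1 ^ 2 + v 2 ^ 2)).const_add 4
    exact (h3.inv (by simp)).congr_deriv (by simp)
  have h4 : HasDerivAt
      (fun t : ℝ => (4 : ℝ) • t • cross v k + (2 : ℝ) • t • t • cross v (cross v k))
      ((4 : ℝ) • cross v k) 0 := by
    have h5 : HasDerivAt (fun t : ℝ => t • cross v k) (cross v k) 0 := by
      simpa using (hasDerivAt_id (0 : ℝ)).smul_const (cross v (k : R3))
    have h6 : HasDerivAt (fun t : ℝ => t • t • cross v (cross v k)) 0 0 := by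
      exact ((hasDerivAt_id (0 : ℝ)).smul
        ((hasDerivAt_id (0 : ℝ)).smul_const (cross v (cross v (k : R3))))).congr_deriv (by simp)
    exact ((h5.const_smul (4 : ℝ)).add (h6.const_smul (2 : ℝ))).congr_deriv (by simp)
  exact ((h2.smul h4).const_add (k : R3)).congr_deriv (by simp)

end

/-! ### Boosts, and the generators as derivatives along families -/

section

variable {m : ℝ}

/-- The boosts, parametrized by the vector `w` of length `sinh η` in the direction of the boost with
rapidity `η`. In this parametrization the boosts are given by formulas smooth at `w = 0`. -/
def boostFamily (w : R3) : Poincare :=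
  if h : w = 0 then 1 else
    boost ⟨‖w‖⁻¹ • w, by simp [norm_smul, h]⟩ (Real.arsinh ‖w‖)

theorem boost_apply (n : Metric.sphere (0 : R3) 1) (η : ℝ) (p : Spacetime) :
    (boost n η).1 p = (Real.cosh η * p.1 + Real.sinh η * inner ℝ (n : R3) p.2,
    p.2 + (Real.sinh η * p.1 + (Real.cosh η - 1) * inner ℝ (n : R3) p.2) • (n : R3)) := rfl

theorem boostFamily_apply (w : R3) (p : Spacetime) :
    (boostFamily w).1 p = (√(1 + ‖w‖ ^ 2) * p.1 + inner ℝ w p.2,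
      p.2 + (p.1 + (1 + √(1 + ‖w‖ ^ 2))⁻¹ * inner ℝ w p.2) • w) := by
  unfold boostFamily
  split_ifs with h
  · subst h
    refine Prod.ext ?_ ?_ <;> simp
  · have h0 : ‖w‖ ≠ 0 := norm_ne_zero_iff.mpr h
    rw [boost_apply]
    simp only [Real.sinh_arsinh, Real.cosh_arsinh, inner_smul_left, conj_trivial]
    refine Prod.ext ?_ ?_
    · simp only; field_simp
    · simp only [smul_smul]
      congr 2
      have h1 : 0 ≤ √(1 + ‖w‖ ^ 2) := Real.sqrt_nonneg _
      have h2 : √(1 + ‖w‖ ^ 2) ^ 2 = 1 + ‖w‖ ^ 2 := Real.sq_sqrt (by positivity)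
      generalize √(1 + ‖w‖ ^ 2) = c at *
      have h3 : 1 + c ≠ 0 := by positivity
      field_simp
      linear_combination inner ℝ w p.2 * h2

theorem boost_eq_boostFamily (n : Metric.sphere (0 : R3) 1) (η : ℝ) :
    boost n η = boostFamily (Real.sinh η • (n : R3)) := by
  refine Subtype.ext (AffineEquiv.ext fun p => ?_)
  have h1 : √(1 + ‖Real.sinh η • (n : R3)‖ ^ 2) = Real.cosh η := by
    rw [norm_smul, norm_eq_of_mem_sphere, mul_one, Real.norm_eq_abs, sq_abs, add_comm,
      ← Real.cosh_sq, Real.sqrt_sq (Real.cosh_pos η).le]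
  rw [boost_apply, boostFamily_apply, h1]
  have h2 := Real.cosh_pos η
  refine Prod.ext ?_ ?_
  · simp [inner_smul_left]
  · simp only [inner_smul_left, conj_trivial, smul_smul]
    congr 2
    field_simp
    linear_combination inner ℝ (n : R3) p.2 * Real.cosh_sq η

theorem boost_neg (n : Metric.sphere (0 : R3) 1) (η : ℝ) : boost n (-η) = (boost n η)⁻¹ := by
  rw [eq_inv_iff_mul_eq_one]
  refine Subtype.ext (AffineEquiv.ext fun p => ?_)
  change boostMap n (-η) (boostMap n η p) = p
  rw [boostMap_comp, neg_add_cancel, boostMap_zero]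

theorem boost_add (n : Metric.sphere (0 : R3) 1) (η ξ : ℝ) :
    boost n (η + ξ) = boost n η * boost n ξ :=
  Subtype.ext (AffineEquiv.ext fun p => (boostMap_comp n η ξ p).symm)

theorem isSmoothFamily_boostFamily : IsSmoothFamily boostFamily where
  contDiff x := by
    simp only [boostFamily_apply]
    have h1 : ContDiff ℝ ∞ fun w : R3 => √(1 + ‖w‖ ^ 2) :=
      (contDiff_const.add (contDiff_id.norm_sq ℝ)).sqrt fun w => by positivity
    have h2 : ContDiff ℝ ∞ fun w : R3 => inner ℝ w x.2 := contDiff_id.inner ℝ contDiff_const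
    have h3 : ContDiff ℝ ∞ fun w : R3 => (1 + √(1 + ‖w‖ ^ 2))⁻¹ :=
      (contDiff_const.add h1).inv fun w => by positivity
    exact ((h1.mul contDiff_const).add h2).prodMk
      (contDiff_const.add ((contDiff_const.add (h3.mul h2)).smul contDiff_id))
  zero := dif_pos rfl
  neg w := by
    by_cases h : w = 0
    · subst h
      simp [boostFamily]
    · obtain ⟨n, η, hn⟩ : ∃ (n : Metric.sphere (0 : R3) 1) (η : ℝ), w = Real.sinh η • (n : R3) := by
        have h0 : ‖w‖ ≠ 0 := norm_ne_zero_iff.mpr h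
        exact ⟨⟨‖w‖⁻¹ • w, by simp [norm_smul, h]⟩, Real.arsinh ‖w‖, by simp [smul_smul, h0]⟩
      rw [hn, ← neg_smul, ← Real.sinh_neg, ← boost_eq_boostFamily, ← boost_eq_boostFamily,
        boost_neg]

theorem velocity_boostFamily (k : shell m) (v : R3) :
    velocity boostFamily k v = energy m k • v := by
  refine velocity_eq_of_hasDerivAt isSmoothFamily_boostFamily ?_
  have h0 : ∀ w : R3, ((boostFamily w • k : shell m) : R3) =
      k + (energy m k + (1 + √(1 + ‖w‖ ^ 2))⁻¹ * inner ℝ w (k : R3)) • w := by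
    intro w
    have h1 : (boostFamily w).1.linear (fourMomentum k) = (boostFamily w).1 (fourMomentum k) := by
      have := (boostFamily w).1.map_vadd 0 (fourMomentum k)
      simp only [vadd_eq_add, add_zero] at this
      rw [this, boostFamily_apply w 0]
      simp
    change ((boostFamily w).1.linear (fourMomentum k)).2 = _
    rw [h1, boostFamily_apply]
    rfl
  simp only [h0]
  set g : R3 → ℝ := fun w => energy m k + (1 + √(1 + ‖w‖ ^ 2))⁻¹ * inner ℝ w (k : R3) with hg
  have h1 : ContDiff ℝ ∞ fun w : R3 => √(1 + ‖w‖ ^ 2) :=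
      (contDiff_const.add (contDiff_id.norm_sq ℝ)).sqrt fun w => by positivity
  have h2 : ContDiff ℝ ∞ fun w : R3 => inner ℝ w (k : R3) := contDiff_id.inner ℝ contDiff_const
  have h3 : ContDiff ℝ ∞ fun w : R3 => (1 + √(1 + ‖w‖ ^ 2))⁻¹ :=
    (contDiff_const.add h1).inv fun w => by positivity
  have h4 : ContDiff ℝ ∞ fun t : ℝ => g (t • v) :=
    (contDiff_const.add (h3.mul h2)).comp (contDiff_id.smul contDiff_const)
  have h5 := (h4.differentiable (by simp) 0).hasDerivAt
  have h6 : HasDerivAt (fun t : ℝ => t • v) v 0 := by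
    simpa using (hasDerivAt_id (0 : ℝ)).smul_const v
  exact ((h5.smul h6).const_add (k : R3)).congr_deriv (by simp [hg])

section

variable {F : Type*} [NormedAddCommGroup F] [NormedSpace ℂ F]
  {E : shell m → Type*} [TopologicalSpace (TotalSpace F E)]
  [∀ k, NormedAddCommGroup (E k)] [∀ k, InnerProductSpace ℂ (E k)]
  [FiberBundle F E] [VectorBundle ℝ F E] (B : ParticleBundle F E)
  {U : Set (shell m)} {ψ ζ : ∀ k, E k} {k : shell m}

theorem hasDerivAt_euclidean {f : ℝ → R3} {f' : R3} {t : ℝ} :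
    HasDerivAt f f' t ↔ ∀ i, HasDerivAt (fun u => f u i) (f' i) t := by
  refine ⟨fun h i => ?_, fun h => ?_⟩
  · exact (EuclideanSpace.proj i : R3 →L[ℝ] ℝ).hasFDerivAt.comp_hasDerivAt t h
  · exact (PiLp.hasFDerivAt_toLp (𝕜 := ℝ) 2 _).comp_hasDerivAt t
      (hasDerivAt_pi (φ := fun u i => f u i).mpr h)

theorem hasDerivAt_entry {M : ℝ → Matrix (Fin 3) (Fin 3) ℝ} {t : ℝ} {Ω : R3}
    (hM : ∀ x : R3, HasDerivAt (fun u => Matrix.toEuclideanLin (M u) x) (cross Ω x) t)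
    (i j : Fin 3) :
    HasDerivAt (fun u => M u i j) (cross Ω (EuclideanSpace.single j 1) i) t := by
  simpa [Matrix.toLpLin_apply] using hasDerivAt_euclidean.mp (hM (EuclideanSpace.single j 1)) i

theorem hasDerivAt_one_add_trace {M : ℝ → Matrix (Fin 3) (Fin 3) ℝ} {t : ℝ} {Ω : R3}
    (hM : ∀ x : R3, HasDerivAt (fun u => Matrix.toEuclideanLin (M u) x) (cross Ω x) t) :
    HasDerivAt (fun u => 1 + (M u).trace) 0 t := by
  have hent := hasDerivAt_entry hM
  simp only [Matrix.trace_fin_three]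
  exact ((((hent 0 0).add (hent 1 1)).add (hent 2 2)).const_add 1).congr_deriv
    (by simp [cross, crossProduct])

theorem cayleyCoord_one : cayleyCoord 1 = 0 := by
  ext i; fin_cases i <;> simp [cayleyCoord]

/-- At the identity, the derivative of the Cayley parameter is the angular velocity. -/
theorem hasDerivAt_cayleyCoord {M : ℝ → Matrix (Fin 3) (Fin 3) ℝ} {t : ℝ} {Ω : R3}
    (h1 : M t = 1)
    (hM : ∀ x : R3, HasDerivAt (fun u => Matrix.toEuclideanLin (M u) x) (cross Ω x) t) :
    HasDerivAt (fun u => cayleyCoord (M u)) Ω t := by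
  have hent := hasDerivAt_entry hM
  have htr := hasDerivAt_one_add_trace hM
  have h4 : (1 : ℝ) + (M t).trace ≠ 0 := by rw [h1]; simp; norm_num
  have key : ∀ i, HasDerivAt (fun u => cayleyCoord (M u) i) (Ω i) t := by
    intro i
    fin_cases i
    · exact ((((hent 2 1).sub (hent 1 2)).const_mul 2).div htr h4).congr_deriv
        (by simp [cross, crossProduct, h1]; ring)
    · exact ((((hent 0 2).sub (hent 2 0)).const_mul 2).div htr h4).congr_deriv
        (by simp [cross, crossProduct, h1]; ring)
    · exact ((((hent 1 0).sub (hent 0 1)).const_mul 2).div htr h4).congr_deriv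
        (by simp [cross, crossProduct, h1]; ring)
  exact hasDerivAt_euclidean.mpr key

/-- The derivative of the action along any curve of rotations through the identity depends only on
the angular velocity there, because the curve factors through the Cayley parametrization. -/
theorem ParticleBundle.hasDerivAt_actSection_rotation (hU : IsOpen U) (hψ : SmoothSection F U ψ)
    (hk : k ∈ U) {R : ℝ → SO3} {t : ℝ} {Ω : R3} (h1 : R t = 1)
    (hR : ∀ x : R3, HasDerivAt (fun u => Matrix.toEuclideanLin (R u).1 x) (cross Ω x) t) :
    HasDerivAt (fun u => B.actSection (rotation (R u)) ψ k) (B.lie rotFamily ψ k Ω) t := by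
  have h1' : (R t).1 = 1 := by rw [h1]; rfl
  have h2 := hasDerivAt_cayleyCoord h1' hR
  have h3 : cayleyCoord (R t).1 = 0 := by rw [h1', cayleyCoord_one]
  have h4 := HasFDerivAt.comp_hasDerivAt (l := fun w => B.actSection (rotFamily w) ψ k) t
    (by rw [h3]; exact B.hasFDerivAt_actSection isSmoothFamily_rotFamily hU hψ hk) h2
  refine h4.congr_of_eventuallyEq ?_
  have h5 : ContinuousAt (fun u => 1 + (R u).1.trace) t :=
    (hasDerivAt_one_add_trace hR).continuousAt
  have h6 : 1 + (R t).1.trace ≠ 0 := by rw [h1']; simp; norm_num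
  filter_upwards [h5.eventually_ne h6] with u hu
  rw [Function.comp_apply, rotFamily, cayley_cayleyCoord _ hu]

theorem ParticleBundle.hasDerivAt_actSection_boost (hU : IsOpen U) (hψ : SmoothSection F U ψ)
    (hk : k ∈ U) (n : Metric.sphere (0 : R3) 1) :
    HasDerivAt (fun η => B.actSection (boost n η) ψ k) (B.lie boostFamily ψ k n) 0 := by
  simp only [boost_eq_boostFamily]
  have h1 : HasDerivAt (fun η : ℝ => Real.sinh η • (n : R3)) (n : R3) 0 := by
    simpa using (Real.hasDerivAt_sinh 0).smul_const (n : R3)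
  exact HasFDerivAt.comp_hasDerivAt (l := fun w => B.actSection (boostFamily w) ψ k) (0 : ℝ)
    (by rw [Real.sinh_zero, zero_smul]
        exact B.hasFDerivAt_actSection isSmoothFamily_boostFamily hU hψ hk) h1

theorem hasDerivAt_axisRotation (a : Fin 3) (x : R3) :
    HasDerivAt (fun u => Matrix.toEuclideanLin (axisRotation a u).1 x)
      (cross (EuclideanSpace.single a 1) x) 0 := by
  have hs := Real.hasDerivAt_sin 0
  have hc := Real.hasDerivAt_cos 0
  rw [Real.cos_zero] at hs
  rw [Real.sin_zero, neg_zero] at hc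
  refine hasDerivAt_euclidean.mpr fun i => ?_
  have key : ∀ p q : ℝ, HasDerivAt (fun u => Real.cos u * p + Real.sin u * q) q 0 :=
    fun p q => ((hc.mul_const p).add (hs.mul_const q)).congr_deriv (by simp)
  fin_cases a <;> fin_cases i <;>
    simp [axisRotation, axisMatrix, cross, crossProduct, Matrix.toLpLin_apply, dotProduct,
      Fin.sum_univ_three]
  · exact hasDerivAt_const _ _
  · simpa using key (x 1) (-x 2)
  · simpa [add_comm] using key (x 2) (x 1)
  · exact key (x 0) (x 2)
  · exact hasDerivAt_const _ _
  · simpa [add_comm] using key (x 2) (-x 0)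
  · simpa using key (x 0) (-x 1)
  · simpa [add_comm] using key (x 1) (x 0)
  · exact hasDerivAt_const _ _

theorem axisRotation_zero (a : Fin 3) : axisRotation a 0 = 1 := by
  refine Subtype.ext ?_
  ext i j
  fin_cases a <;> fin_cases i <;> fin_cases j <;> simp [axisRotation, axisMatrix]

theorem ParticleBundle.opJ_eq (hU : IsOpen U) (hψ : SmoothSection F U ψ) (hk : k ∈ U)
    (a : Fin 3) :
    B.opJ a ψ k = Complex.I • B.lie rotFamily ψ k (EuclideanSpace.single a 1) := by
  rw [opJ, (B.hasDerivAt_actSection_rotation hU hψ hk (axisRotation_zero a)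
    (hasDerivAt_axisRotation a)).deriv]

theorem ParticleBundle.opK_eq (hU : IsOpen U) (hψ : SmoothSection F U ψ) (hk : k ∈ U)
    (a : Fin 3) :
    B.opK a ψ k = -Complex.I • B.lie boostFamily ψ k (EuclideanSpace.single a 1) := by
  rw [opK, (B.hasDerivAt_actSection_boost hU hψ hk (unitVec a)).deriv]
  rfl

end

end

/-! ### A coordinate-free formula for the rotation connection -/

section

variable {m : ℝ}

theorem isOpen_punctured : IsOpen (punctured m) :=
  isOpen_ne.preimage continuous_subtype_val

theorem norm_pos_of_mem_punctured {k : shell m} (hk : k ∈ punctured m) : 0 < ‖(k : R3)‖ :=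
  norm_pos_iff.mpr hk

variable {F : Type*} [NormedAddCommGroup F] [NormedSpace ℂ F]
  {E : shell m → Type*} [TopologicalSpace (TotalSpace F E)]
  [∀ k, NormedAddCommGroup (E k)] [∀ k, InnerProductSpace ℂ (E k)]
  [FiberBundle F E] [VectorBundle ℝ F E] (B : ParticleBundle F E)
  {U : Set (shell m)} {ψ ζ : ∀ k, E k} {k : shell m}

namespace ParticleBundle

/-- The rotation connection at `k` in the direction `v`, written without coordinates as
`|k|⁻² L_rot (v × k) - ⟨k, v⟩ / (ω |k|²) L_boost k - ⟨k, v⟩ / (2 ω²)`, where `L_rot` and `L_boost`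
are the derivatives of the action along rotations and boosts. The real coefficients are cast to `ℂ`
so that all scalars act through the complex structure of the fibers. -/
def covDeriv (ψ : ∀ k, E k) (k : shell m) (v : R3) : E k :=
  (((‖(k : R3)‖ ^ 2)⁻¹ : ℝ) : ℂ) • B.lie rotFamily ψ k (cross v k) -
    (((energy m k * ‖(k : R3)‖ ^ 2)⁻¹ * inner ℝ (k : R3) v : ℝ) : ℂ) • B.lie boostFamily ψ k k -
    ((inner ℝ (k : R3) v / (2 * energy m k ^ 2) : ℝ) : ℂ) • ψ k

omit [FiberBundle F E] [VectorBundle ℝ F E] [TopologicalSpace (TotalSpace F E)]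
  [NormedAddCommGroup F] [NormedSpace ℂ F] in
theorem clm_apply_eq_sum (L : R3 →L[ℝ] E k) (v : R3) :
    L v = ((v 0 : ℝ) : ℂ) • L (EuclideanSpace.single 0 1) +
      ((v 1 : ℝ) : ℂ) • L (EuclideanSpace.single 1 1) +
      ((v 2 : ℝ) : ℂ) • L (EuclideanSpace.single 2 1) := by
  have h : v = v 0 • EuclideanSpace.single 0 1 + v 1 • EuclideanSpace.single 1 1 +
      v 2 • EuclideanSpace.single 2 1 := by
    ext i; fin_cases i <;> simp
  conv_lhs => rw [h]
  simp only [map_add, map_smul, Complex.coe_smul]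

theorem rotationComp_eq_covDeriv (hψ : SmoothSection F (punctured m) ψ) (hk : k ∈ punctured m)
    (a : Fin 3) :
    B.rotationComp a ψ k = B.covDeriv ψ k (EuclideanSpace.single a 1) := by
  have hJ := B.opJ_eq isOpen_punctured hψ hk
  have hK := B.opK_eq isOpen_punctured hψ hk
  have hn : ((‖(k : R3)‖ : ℝ) : ℂ) ≠ 0 :=
    Complex.ofReal_ne_zero.mpr (norm_pos_of_mem_punctured hk).ne'
  have hω : ((energy m k : ℝ) : ℂ) ≠ 0 := Complex.ofReal_ne_zero.mpr (energy_pos k).ne'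
  have hI := Complex.I_sq
  rw [covDeriv, clm_apply_eq_sum (B.lie rotFamily ψ k), clm_apply_eq_sum (B.lie boostFamily ψ k)]
  simp only [rotationComp, opDot, Pi.smul_apply, Pi.sub_apply, Pi.add_apply, Function.comp_apply,
    opPinv, opHinv, opP, mulOp, Fin.sum_univ_three, opPhat, hK]
  generalize B.lie boostFamily ψ k (EuclideanSpace.single 0 1) = N0
  generalize B.lie boostFamily ψ k (EuclideanSpace.single 1 1) = N1
  generalize B.lie boostFamily ψ k (EuclideanSpace.single 2 1) = N2
  fin_cases a <;>
  · simp only [opCross, Fin.zero_eta, Fin.mk_one, Fin.reduceFinMk, Matrix.cons_val_zero,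
      Matrix.cons_val_one, Matrix.cons_val, Pi.sub_apply, Function.comp_apply, opPhat, mulOp, hJ]
    generalize B.lie rotFamily ψ k (EuclideanSpace.single 0 1) = L0
    generalize B.lie rotFamily ψ k (EuclideanSpace.single 1 1) = L1
    generalize B.lie rotFamily ψ k (EuclideanSpace.single 2 1) = L2
    simp [cross, crossProduct, EuclideanSpace.inner_single_right]
    match_scalars <;> field_simp <;> ring_nf <;> simp [hI]; ring

theorem cross_add_left (x y z : R3) : cross (x + y) z = cross x z + cross y z := by
  simp [cross]

omit [VectorBundle ℝ F E] in
theorem covDeriv_add_right (ψ : ∀ k, E k) (k : shell m) (v w : R3) :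
    B.covDeriv ψ k (v + w) = B.covDeriv ψ k v + B.covDeriv ψ k w := by
  simp only [covDeriv, cross_add_left, map_add, inner_add_right, mul_add, add_div,
    Complex.ofReal_add, smul_add, add_smul]
  abel

omit [VectorBundle ℝ F E] in
theorem covDeriv_smul_right (ψ : ∀ k, E k) (k : shell m) (c : ℝ) (v : R3) :
    B.covDeriv ψ k (c • v) = (c : ℂ) • B.covDeriv ψ k v := by
  simp only [covDeriv, cross_smul_left, map_smul, inner_smul_right, ← Complex.coe_smul]
  push_cast
  module

omit [VectorBundle ℝ F E] in
theorem sum_smul_covDeriv (ψ : ∀ k, E k) (k : shell m) (v : R3) :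
    ∑ a, ((v a : ℝ) : ℂ) • B.covDeriv ψ k (EuclideanSpace.single a 1) = B.covDeriv ψ k v := by
  have h : v = v 0 • EuclideanSpace.single 0 1 + v 1 • EuclideanSpace.single 1 1 +
      v 2 • EuclideanSpace.single 2 1 := by
    ext i; fin_cases i <;> simp
  conv_rhs => rw [h]
  simp only [covDeriv_add_right, covDeriv_smul_right, Fin.sum_univ_three]

theorem rotationConnection_eq_covDeriv (hψ : SmoothSection F (punctured m) ψ)
    (hk : k ∈ punctured m) {X : VectorField m} {v : R3} (hX : ∀ a, X k a = (v a : ℂ)) :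
    B.rotationConnection X ψ k = B.covDeriv ψ k v := by
  simp only [rotationConnection, alongField, hX, B.rotationComp_eq_covDeriv hψ hk,
    sum_smul_covDeriv]

theorem cross_cross_self (v k : R3) :
    cross (cross v k) k = (inner ℝ k v) • k - (‖k‖ ^ 2) • v := by
  rw [EuclideanSpace.real_norm_sq_eq, PiLp.inner_apply]
  ext i
  fin_cases i <;> simp [cross, crossProduct, Fin.sum_univ_three] <;> ring

/-- The Leibniz rule. Rotations contribute the part of `v` orthogonal to `k` and boosts the radial
part, by `(v × k) × k = ⟨k, v⟩ k - |k|² v`. -/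
theorem covDeriv_smul (hψ : SmoothSection F (punctured m) ψ) (hk : k ∈ punctured m)
    {f : shell m → ℂ} (hf : ContMDiffAt 𝓘(ℝ, R3) 𝓘(ℝ, ℂ) ∞ f k) (v : R3) :
    B.covDeriv (fun k => f k • ψ k) k v =
      fderiv ℝ (extendZero f) (k : R3) v • ψ k + f k • B.covDeriv ψ k v := by
  have hn : ((‖(k : R3)‖ : ℝ) : ℂ) ≠ 0 :=
    Complex.ofReal_ne_zero.mpr (norm_pos_of_mem_punctured hk).ne'
  have hω : ((energy m k : ℝ) : ℂ) ≠ 0 := Complex.ofReal_ne_zero.mpr (energy_pos k).ne'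
  simp only [covDeriv, B.lie_smul isSmoothFamily_rotFamily isOpen_punctured hψ hk hf,
    B.lie_smul isSmoothFamily_boostFamily isOpen_punctured hψ hk hf, velocity_rotFamily,
    velocity_boostFamily, cross_cross_self, map_sub, map_smul, Complex.real_smul]
  push_cast
  match_scalars <;> field_simp; ring

theorem covDeriv_add (hψ : SmoothSection F (punctured m) ψ)
    (hζ : SmoothSection F (punctured m) ζ) (hk : k ∈ punctured m) (v : R3) :
    B.covDeriv (ψ + ζ) k v = B.covDeriv ψ k v + B.covDeriv ζ k v := by
  simp only [covDeriv, B.lie_add isSmoothFamily_rotFamily isOpen_punctured hψ hζ hk,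
    B.lie_add isSmoothFamily_boostFamily isOpen_punctured hψ hζ hk, Pi.add_apply,
    add_apply]
  module

omit [VectorBundle ℝ F E] in
theorem covDeriv_congr (hk : k ∈ punctured m) (h : ∀ k ∈ punctured m, ψ k = ζ k) (v : R3) :
    B.covDeriv ψ k v = B.covDeriv ζ k v := by
  simp only [covDeriv, B.lie_congr isSmoothFamily_rotFamily isOpen_punctured hk h,
    B.lie_congr isSmoothFamily_boostFamily isOpen_punctured hk h, h k hk]

/-- The connection fails to preserve the Hermitian metric of the fibers by exactly the logarithmic
derivative of the energy, which is the density of the measure. -/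
theorem inner_covDeriv_add_inner_covDeriv (hψ : SmoothSection F (punctured m) ψ)
    (hζ : SmoothSection F (punctured m) ζ) (hk : k ∈ punctured m) (v : R3) :
    inner ℂ (B.covDeriv ψ k v) (ζ k) + inner ℂ (ψ k) (B.covDeriv ζ k v) =
      fderiv ℝ (extendZero fun k => inner ℂ (ψ k) (ζ k)) (k : R3) v -
        ((inner ℝ (k : R3) v / energy m k ^ 2 : ℝ) : ℂ) * inner ℂ (ψ k) (ζ k) := by
  have hn : ((‖(k : R3)‖ : ℝ) : ℂ) ≠ 0 :=
    Complex.ofReal_ne_zero.mpr (norm_pos_of_mem_punctured hk).ne'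
  have hω : ((energy m k : ℝ) : ℂ) ≠ 0 := Complex.ofReal_ne_zero.mpr (energy_pos k).ne'
  have h1 := B.inner_lie_add_inner_lie isSmoothFamily_rotFamily isOpen_punctured hψ hζ hk
    (cross v k)
  have h2 := B.inner_lie_add_inner_lie isSmoothFamily_boostFamily isOpen_punctured hψ hζ hk k
  rw [velocity_rotFamily, cross_cross_self, map_sub, map_smul, map_smul, Complex.real_smul,
    Complex.real_smul] at h1
  rw [velocity_boostFamily, map_smul, Complex.real_smul] at h2
  simp only [covDeriv, inner_sub_left, inner_sub_right, inner_smul_left, inner_smul_right,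
    Complex.conj_ofReal]
  push_cast at h1 h2 ⊢
  linear_combination (norm := skip) ((‖(k : R3)‖ : ℂ) ^ 2)⁻¹ * h1 -
    ((energy m k : ℂ) * (‖(k : R3)‖ : ℂ) ^ 2)⁻¹ * (inner ℝ (k : R3) v : ℝ) * h2
  field_simp
  ring

end ParticleBundle

end

/-! ### The symmetrized expression -/

section

variable {m : ℝ}

theorem contMDiffAt_ofReal {g : R3 → ℝ} {k : shell m} (hg : ContDiffAt ℝ ∞ g (k : R3)) :
    ContMDiffAt 𝓘(ℝ, R3) 𝓘(ℝ, ℂ) ∞ (fun k : shell m => (g k : ℂ)) k :=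
  contMDiffAt_of_contDiffAt (f := fun x => (g x : ℂ))
    (Complex.ofRealCLM.contDiff.contDiffAt.comp (k : R3) hg)

theorem fderiv_extendZero_ofReal {g : R3 → ℝ} {k : shell m} {g' : R3 →L[ℝ] ℝ}
    (hg : HasFDerivAt g g' (k : R3)) (v : R3) :
    fderiv ℝ (extendZero fun k : shell m => (g k : ℂ)) (k : R3) v = (g' v : ℂ) := by
  have h1 : HasFDerivAt (fun x => (g x : ℂ)) (Complex.ofRealCLM ∘L g') (k : R3) :=
    Complex.ofRealCLM.hasFDerivAt.comp (k : R3) hg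
  have h2 : extendZero (fun k : shell m => (g k : ℂ)) =ᶠ[𝓝 (k : R3)] fun x => (g x : ℂ) := by
    filter_upwards [(shell m).isOpen.mem_nhds k.2] with x hx
    exact extendZero_coe (fun k : shell m => (g k : ℂ)) ⟨x, hx⟩
  rw [h2.fderiv_eq, h1.fderiv]
  rfl

/-- The functions `x_a x_b / (|x|² ω)` of the momentum `x`, the coefficients of the boost generators
in the radial part of the connection. -/
def radialWeight (m : ℝ) (a b : Fin 3) (x : R3) : ℝ :=
  x b * x a * (‖x‖ ^ 2)⁻¹ * (energy m x)⁻¹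

theorem contDiffAt_coord (a : Fin 3) (x : R3) : ContDiffAt ℝ ∞ (fun x : R3 => x a) x :=
  (EuclideanSpace.proj a : R3 →L[ℝ] ℝ).contDiff.contDiffAt

theorem contDiffAt_radialWeight (a b : Fin 3) {k : shell m} (hk : k ∈ punctured m) :
    ContDiffAt ℝ ∞ (radialWeight m a b) (k : R3) := by
  have hn := norm_pos_of_mem_punctured hk
  exact (((contDiffAt_coord b _).mul (contDiffAt_coord a _)).mul
    ((contDiff_id.norm_sq ℝ).contDiffAt.inv (by simpa using hn.ne'))).mul
    ((contDiffAt_energy k).inv (energy_pos k).ne')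

theorem fderiv_radialWeight (a b : Fin 3) {k : shell m} (hk : k ∈ punctured m) (v : R3) :
    fderiv ℝ (radialWeight m a b) (k : R3) v =
      (v b * (k : R3) a + (k : R3) b * v a) / (‖(k : R3)‖ ^ 2 * energy m k) -
      (k : R3) b * (k : R3) a * inner ℝ (k : R3) v *
        (2 / (‖(k : R3)‖ ^ 4 * energy m k) + 1 / (‖(k : R3)‖ ^ 2 * energy m k ^ 3)) := by
  have hn := (norm_pos_of_mem_punctured hk).ne'
  have hω := (energy_pos k).ne'
  have h1 : ∀ a, HasFDerivAt (fun x : R3 => x a) (EuclideanSpace.proj a : R3 →L[ℝ] ℝ) (k : R3) :=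
    fun a => (EuclideanSpace.proj a : R3 →L[ℝ] ℝ).hasFDerivAt
  have h2 : HasFDerivAt (fun x : R3 => (‖x‖ ^ 2)⁻¹) _ (k : R3) :=
    (hasDerivAt_inv (by simpa using hn)).comp_hasFDerivAt (k : R3)
      (hasFDerivAt_id (k : R3)).norm_sq
  have h3 : HasFDerivAt (fun x : R3 => (energy m x)⁻¹) _ (k : R3) :=
    (hasDerivAt_inv hω).comp_hasFDerivAt (k : R3) (hasFDerivAt_energy k)
  have h4 := (((h1 b).mul (h1 a)).mul h2).mul h3
  have h5 : HasFDerivAt (radialWeight m a b) _ (k : R3) := h4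
  rw [h5.fderiv]
  simp
  field_simp
  ring

/-- The divergence of the coefficients, which is what the commutation of boost generators past them
produces. -/
theorem sum_fderiv_radialWeight (a : Fin 3) {k : shell m} (hk : k ∈ punctured m) :
    ∑ b, fderiv ℝ (radialWeight m a b) (k : R3) (EuclideanSpace.single b 1) =
      (k : R3) a * (2 / (‖(k : R3)‖ ^ 2 * energy m k) - 1 / energy m k ^ 3) := by
  have hn := (norm_pos_of_mem_punctured hk).ne'
  have hω := (energy_pos k).ne'
  have h1 := EuclideanSpace.real_norm_sq_eq (k : R3)
  simp only [Fin.sum_univ_three] at h1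
  simp only [fderiv_radialWeight _ _ hk, Fin.sum_univ_three, EuclideanSpace.inner_single_right]
  have h2 : ∀ c d : ℝ, (k : R3) 0 * (k : R3) a * ((k : R3) 0) * (2 / c + 1 / d) +
      (k : R3) 1 * (k : R3) a * ((k : R3) 1) * (2 / c + 1 / d) +
      (k : R3) 2 * (k : R3) a * ((k : R3) 2) * (2 / c + 1 / d) =
      (k : R3) a * ‖(k : R3)‖ ^ 2 * (2 / c + 1 / d) := by
    intro c d; rw [h1]; ring
  have h3 := h2 (‖(k : R3)‖ ^ 4 * energy m k) (‖(k : R3)‖ ^ 2 * energy m k ^ 3)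
  have h4 : (k : R3) a * (2 / (‖(k : R3)‖ ^ 2 * energy m k) - 1 / energy m k ^ 3) =
    4 * (k : R3) a / (‖(k : R3)‖ ^ 2 * energy m k) - (k : R3) a * ‖(k : R3)‖ ^ 2 *
      (2 / (‖(k : R3)‖ ^ 4 * energy m k) + 1 / (‖(k : R3)‖ ^ 2 * energy m k ^ 3)) := by
    field_simp; ring
  rw [h4, ← h3]
  fin_cases a <;> simp <;> ring

variable {F : Type*} [NormedAddCommGroup F] [NormedSpace ℂ F]
  {E : shell m → Type*} [TopologicalSpace (TotalSpace F E)]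
  [∀ k, NormedAddCommGroup (E k)] [∀ k, InnerProductSpace ℂ (E k)]
  [FiberBundle F E] [VectorBundle ℂ F E] [VectorBundle ℝ F E] (B : ParticleBundle F E)
  {U : Set (shell m)} {ψ ζ : ∀ k, E k} {k : shell m}

namespace ParticleBundle

/-- The commutator `[K_b, g] = i ω ∂_b g` of a boost generator with a function of momentum. -/
theorem opK_smul (hψ : SmoothSection F (punctured m) ψ) (hk : k ∈ punctured m) {g : R3 → ℝ}
    (hg : ∀ k ∈ punctured m, ContDiffAt ℝ ∞ g (k : R3)) (b : Fin 3) :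
    B.opK b (fun k => (g k : ℂ) • ψ k) k = (g k : ℂ) • B.opK b ψ k +
      (Complex.I * energy m k * (fderiv ℝ g (k : R3) (EuclideanSpace.single b 1) : ℝ)) • ψ k := by
  have h1 : ContMDiffOn 𝓘(ℝ, R3) 𝓘(ℝ, ℂ) ∞ (fun k : shell m => (g k : ℂ)) (punctured m) :=
    fun k hk => (contMDiffAt_ofReal (hg k hk)).contMDiffWithinAt
  rw [B.opK_eq isOpen_punctured (hψ.smul isOpen_punctured h1) hk,
    B.opK_eq isOpen_punctured hψ hk, B.lie_smul isSmoothFamily_boostFamily isOpen_punctured hψ hk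
    (contMDiffAt_ofReal (hg k hk)), velocity_boostFamily,
    fderiv_extendZero_ofReal ((hg k hk).differentiableAt (by simp)).hasFDerivAt, map_smul,
    smul_eq_mul]
  push_cast
  module

theorem rotationComp_eq_rotationCompSymm (hψ : SmoothSection F (punctured m) ψ)
    (hk : k ∈ punctured m) (a : Fin 3) :
    B.rotationComp a ψ k = B.rotationCompSymm a ψ k := by
  have hn : ((‖(k : R3)‖ : ℝ) : ℂ) ≠ 0 :=
    Complex.ofReal_ne_zero.mpr (norm_pos_of_mem_punctured hk).ne'
  have hω : ((energy m k : ℝ) : ℂ) ≠ 0 := Complex.ofReal_ne_zero.mpr (energy_pos k).ne'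
  have h1 : ∀ b, B.opK b (opPhat b (opPhat a (opHinv ψ))) k =
      (radialWeight m a b k : ℂ) • B.opK b ψ k + (Complex.I * energy m k *
        (fderiv ℝ (radialWeight m a b) (k : R3) (EuclideanSpace.single b 1) : ℝ)) • ψ k := by
    intro b
    rw [← B.opK_smul hψ hk (fun k hk => contDiffAt_radialWeight a b hk)]
    congr 1
    funext k
    simp only [opPhat, opHinv, mulOp, smul_smul, radialWeight]
    push_cast
    congr 1
    field_simp
  have h2 : opDot B.opK opPhat (opPhat a (opHinv ψ)) k =
      (∑ b, (radialWeight m a b k : ℂ) • B.opK b ψ k) + (Complex.I * energy m k *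
        ((k : R3) a * (2 / (‖(k : R3)‖ ^ 2 * energy m k) - 1 / energy m k ^ 3) : ℝ)) • ψ k := by
    rw [← sum_fderiv_radialWeight a hk]
    simp only [opDot, Finset.sum_apply, Function.comp_apply, h1, Finset.sum_add_distrib,
      ← Finset.sum_smul, ← Finset.mul_sum, Complex.ofReal_sum]
  simp only [rotationComp, rotationCompSymm, Pi.smul_apply, Pi.sub_apply, Pi.add_apply,
    Function.comp_apply, h2]
  simp only [opPinv, opHinv, opP, opPhat, mulOp, opDot, Function.comp_apply, Fin.sum_univ_three,
    Pi.add_apply, radialWeight]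
  generalize opCross _ B.opJ a ψ k = L
  push_cast
  match_scalars <;> field_simp <;> ring_nf

end ParticleBundle

end

/-! ### The connection and its parallel transport -/

section

variable {m : ℝ}

variable {F : Type*} [NormedAddCommGroup F] [NormedSpace ℂ F]
  {E : shell m → Type*} [TopologicalSpace (TotalSpace F E)]
  [∀ k, NormedAddCommGroup (E k)] [∀ k, InnerProductSpace ℂ (E k)]
  [FiberBundle F E]
  {U : Set (shell m)} {ψ ζ : ∀ k, E k} {k : shell m}

omit [∀ k, InnerProductSpace ℂ (E k)] in
theorem SmoothSection.congr (hψ : SmoothSection F U ψ) (h : ∀ k ∈ U, ψ k = ζ k) :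
    SmoothSection F U ζ :=
  ContMDiffOn.congr hψ fun k hk => by rw [h k hk]

variable [VectorBundle ℂ F E] [VectorBundle ℝ F E] (B : ParticleBundle F E)

namespace ParticleBundle

theorem smoothSection_covDeriv (hψ : SmoothSection F (punctured m) ψ) (v : R3) :
    SmoothSection F (punctured m) (fun k => B.covDeriv ψ k v) := by
  have hsmul : ∀ {g : R3 → ℝ} {χ : ∀ k, E k}, SmoothSection F (punctured m) χ →
      (∀ k ∈ punctured m, ContDiffAt ℝ ∞ g (k : R3)) →
      SmoothSection F (punctured m) (fun k => (g k : ℂ) • χ k) := fun hχ hg =>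
    hχ.smul isOpen_punctured fun k hk => (contMDiffAt_ofReal (hg k hk)).contMDiffWithinAt
  have hlie : ∀ {γ : R3 → Poincare}, IsSmoothFamily γ → ∀ {u : R3 → R3}, ContDiff ℝ ∞ u →
      SmoothSection F (punctured m) (fun k => B.lie γ ψ k (u k)) := by
    intro γ hγ u hu
    have hu' : ∀ i, ∀ k ∈ punctured m, ContDiffAt ℝ ∞ (fun x => u x i) ((k : shell m) : R3) :=
      fun i k _ => (contDiff_euclidean.mp hu i).contDiffAt
    have hs := fun i =>
      hsmul (B.smoothSection_lie hγ isOpen_punctured hψ (EuclideanSpace.single i 1)) (hu' i)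
    exact (((hs 0).add isOpen_punctured (hs 1)).add isOpen_punctured (hs 2)).congr
      fun k _ => (clm_apply_eq_sum _ _).symm
  have hn : ∀ k ∈ punctured m, ContDiffAt ℝ ∞ (fun x : R3 => ‖x‖ ^ 2) ((k : shell m) : R3) :=
    fun k _ => (contDiff_id.norm_sq ℝ).contDiffAt
  have hi : ∀ k ∈ punctured m, ContDiffAt ℝ ∞ (fun x : R3 => inner ℝ x v) ((k : shell m) : R3) :=
    fun k _ => (contDiff_id.inner ℝ contDiff_const).contDiffAt
  have h1 := hsmul (hlie isSmoothFamily_rotFamily (u := fun x => cross v x)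
    (contDiff_cross contDiff_const contDiff_id))
    (g := fun x => (‖x‖ ^ 2)⁻¹) fun k hk => (hn k hk).inv
      (pow_ne_zero 2 (norm_pos_of_mem_punctured hk).ne')
  have h2 := hsmul (hlie isSmoothFamily_boostFamily (u := fun x => x) contDiff_id)
    (g := fun x => -((energy m x * ‖x‖ ^ 2)⁻¹ * inner ℝ x v)) fun k hk =>
      ((((contDiffAt_energy k).mul (hn k hk)).inv (mul_ne_zero (energy_pos k).ne'
        (pow_ne_zero 2 (norm_pos_of_mem_punctured hk).ne'))).mul (hi k hk)).neg
  have h3 := hsmul hψ (g := fun x => -(inner ℝ x v / (2 * energy m x ^ 2))) fun k hk =>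
    ((hi k hk).div (contDiffAt_const.mul ((contDiffAt_energy k).pow 2))
      (mul_ne_zero two_ne_zero (pow_ne_zero 2 (energy_pos k).ne'))).neg
  refine ((h1.add isOpen_punctured h2).add isOpen_punctured h3).congr fun k _ => ?_
  simp only [covDeriv, Complex.ofReal_neg, neg_smul, ← sub_eq_add_neg]

theorem isConnectionOn_rotationConnection :
    IsConnectionOn F B.rotationConnection (punctured m) where
  congr X Y ψ ζ _ hψ hXY h k hk := by
    have hζ := hψ.congr h
    simp only [rotationConnection, alongField, B.rotationComp_eq_covDeriv hψ hk,
      B.rotationComp_eq_covDeriv hζ hk, B.covDeriv_congr hk h, hXY k hk]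
  smooth X ψ hX hψ := by
    have h1 : ∀ a, SmoothSection F (punctured m) (fun k => X k a • B.rotationComp a ψ k) :=
      fun a => ((B.smoothSection_covDeriv hψ (EuclideanSpace.single a 1)).congr fun k hk =>
        (B.rotationComp_eq_covDeriv hψ hk a).symm).smul isOpen_punctured (hX a)
    refine (((h1 0).add isOpen_punctured (h1 1)).add isOpen_punctured (h1 2)).congr
      fun k _ => ?_
    simp only [rotationConnection, alongField, Fin.sum_univ_three]
  add_field X Y ψ _ _ _ k _ := by
    simp only [rotationConnection, alongField, Pi.add_apply, add_smul, Finset.sum_add_distrib]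
  smul_field f X ψ _ _ _ k _ := by
    simp only [rotationConnection, alongField, Pi.smul_apply, smul_assoc, Finset.smul_sum]
  add_section X ψ ζ _ hψ hζ k hk := by
    have hψζ : SmoothSection F (punctured m) (ψ + ζ) := hψ.add isOpen_punctured hζ
    simp only [rotationConnection, alongField, B.rotationComp_eq_covDeriv hψ hk,
      B.rotationComp_eq_covDeriv hζ hk, B.rotationComp_eq_covDeriv hψζ hk,
      B.covDeriv_add hψ hζ hk, smul_add, Finset.sum_add_distrib]
  leibniz f X ψ hf hX hψ k hk := by
    have hfk := (hf k hk).contMDiffAt (isOpen_punctured.mem_nhds hk)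
    simp only [rotationConnection, alongField, B.rotationComp_eq_covDeriv hψ hk,
      B.rotationComp_eq_covDeriv (hψ.smul isOpen_punctured hf) hk,
      B.covDeriv_smul hψ hk hfk, dirDeriv, mvfderiv_eq_fderiv_extendZero hfk, smul_add,
      Finset.sum_add_distrib, Finset.sum_smul, Finset.smul_sum, smul_smul, mul_comm (f k)]

omit [VectorBundle ℂ F E] [VectorBundle ℝ F E] in
/-- The derivative of a section in a frame transported by the group, in terms of the derivative of
the action on sections. -/
theorem hasDerivAt_act_symm {g : ℝ → Poincare} {t : ℝ} {u : E (g t • k)}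
    (h : HasDerivAt (fun s => B.actSection (g t * (g s)⁻¹) ψ (g t • k)) u t) :
    HasDerivAt (fun s => (B.act (g s) k).symm (ψ (g s • k))) ((B.act (g t) k).symm u) t := by
  simp only [fun s => B.act_symm_eq_actSection (g s) (g t) ψ k]
  exact (((B.act (g t) k).symm.toContinuousLinearEquiv.toContinuousLinearMap).restrictScalars
    ℝ).hasFDerivAt.comp_hasDerivAt t h

end ParticleBundle

theorem toEuclideanLin_mul (R S : SO3) (x : R3) :
    Matrix.toEuclideanLin (R * S).1 x =
      Matrix.toEuclideanLin R.1 (Matrix.toEuclideanLin S.1 x) := by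
  simp [Matrix.toLpLin_apply, Matrix.mulVec_mulVec]

theorem rotation_smul_mem_punctured (hk : k ∈ punctured m) (R : SO3) :
    rotation R • k ∈ punctured m := by
  intro h
  refine hk ?_
  have h1 : rotation R⁻¹ • rotation R • k = k := by rw [rotation_inv, inv_smul_smul]
  rw [← h1, coe_rotation_smul, h, map_zero]

/-- The rotations `R t (R u)⁻¹`, which are the identity at `u = t`, have there the angular velocity
opposite to that of `R`. -/
theorem hasDerivAt_mul_inv {R : ℝ → SO3} {Ω : R3} {t : ℝ}
    (hR : ∀ x : R3, HasDerivAt (fun u => Matrix.toEuclideanLin (R u).1 x)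
        (cross Ω (Matrix.toEuclideanLin (R t).1 x)) t) (x : R3) :
    HasDerivAt (fun u => Matrix.toEuclideanLin (R t * (R u)⁻¹).1 x) (cross (-Ω) x) t := by
  have h1 : ∀ x : R3, HasDerivAt (fun u => Matrix.toEuclideanLin (R u * (R t)⁻¹).1 x)
      (cross Ω x) t := by
    intro x
    simp only [toEuclideanLin_mul]
    refine (hR _).congr_deriv ?_
    rw [← toEuclideanLin_mul, mul_inv_cancel]
    simp
  have h2 := hasDerivAt_entry h1
  have h3 : ∀ u, (R t * (R u)⁻¹).1 = (R u * (R t)⁻¹).1.transpose := by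
    intro u
    have h4 : R t * (R u)⁻¹ = (R u * (R t)⁻¹)⁻¹ := by rw [mul_inv_rev, inv_inv]
    rw [h4]
    rfl
  refine hasDerivAt_euclidean.mpr fun i => ?_
  simp only [h3, Matrix.toLpLin_apply, Matrix.mulVec, dotProduct, Matrix.transpose_apply,
    Fin.sum_univ_three]
  refine ((((h2 0 i).mul_const (x 0)).add ((h2 1 i).mul_const (x 1))).add
    ((h2 2 i).mul_const (x 2))).congr_deriv ?_
  fin_cases i <;> simp [cross, crossProduct] <;> ring

theorem inner_cross_self (v k : R3) : inner ℝ k (cross v k) = (0 : ℝ) := by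
  simp [PiLp.inner_apply, cross, crossProduct, Fin.sum_univ_three]; ring

namespace ParticleBundle

omit [VectorBundle ℂ F E] [VectorBundle ℝ F E] in
/-- In a tangential direction the connection is the infinitesimal rotation without twist. -/
theorem covDeriv_cross (ψ : ∀ k, E k) (hk : k ∈ punctured m) {Ω : R3}
    (hΩ : inner ℝ Ω (k : R3) = (0 : ℝ)) :
    B.covDeriv ψ k (cross Ω k) = B.lie rotFamily ψ k (-Ω) := by
  have hn := (norm_pos_of_mem_punctured hk).ne'
  rw [covDeriv, cross_cross_self, inner_cross_self, real_inner_comm, hΩ, zero_smul, zero_sub,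
    ← smul_neg, map_smul, Complex.coe_smul, smul_smul, inv_mul_cancel₀ (pow_ne_zero 2 hn)]
  simp

omit [VectorBundle ℂ F E] [VectorBundle ℝ F E] in
/-- In the radial direction the connection is the infinitesimal boost, up to a scalar term. -/
theorem covDeriv_radial (ψ : ∀ k, E k) {n : R3} (hn : ‖n‖ = 1) {s : ℝ} (hs : 0 < s)
    (hk : (k : R3) = s • n) :
    B.covDeriv ψ k (energy m k • n) =
      -B.lie boostFamily ψ k n - ((s / (2 * energy m k) : ℝ) : ℂ) • ψ k := by
  have hω := energy_pos k
  have hns : ‖(k : R3)‖ = s := by rw [hk, norm_smul, hn, mul_one, Real.norm_of_nonneg hs.le]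
  have h6 : cross (energy m k • n) (k : R3) = 0 := by
    generalize energy m k = w
    rw [hk]; simp [cross]
  have h7 : (inner ℝ (k : R3) (energy m k • n) : ℝ) = s * energy m k := by
    generalize energy m k = w
    rw [hk, inner_smul_left, inner_smul_right, real_inner_self_eq_norm_sq, hn]
    simp
  have h8 : B.lie boostFamily ψ k k = (s : ℂ) • B.lie boostFamily ψ k n := by
    rw [Complex.coe_smul, ← map_smul, ← hk]
  rw [covDeriv, hns, h6, h7, h8, map_zero, smul_zero, zero_sub, smul_smul]
  have h9 : (((energy m k * s ^ 2)⁻¹ * (s * energy m k) : ℝ) : ℂ) * s = 1 := by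
    rw [← Complex.ofReal_mul, ← Complex.ofReal_one]
    congr 1
    field_simp
  have h10 : s * energy m k / (2 * energy m k ^ 2) = s / (2 * energy m k) := by field_simp
  rw [h9, h10, one_smul]

omit [VectorBundle ℂ F E] in
theorem isParallelTransport_rotation (hk : k ∈ punctured m) {R : ℝ → SO3} {Ω : ℝ → R3}
    (hR : ∀ (t : ℝ) (x : R3), HasDerivAt (fun u => Matrix.toEuclideanLin (R u).1 x)
        (cross (Ω t) (Matrix.toEuclideanLin (R t).1 x)) t)
    (hΩ : ∀ t, inner ℝ (Ω t) (rotation (R t) • k : shell m) = (0 : ℝ)) :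
    IsParallelTransport F B.rotationConnection (punctured m) (fun t => rotation (R t) • k) Set.univ
      (fun t => (B.act (rotation (R t)) k).toLinearEquiv) := by
  intro t _
  have hkt := rotation_smul_mem_punctured hk (R t)
  refine ⟨hkt, cross (Ω t) (rotation (R t) • k : shell m), hR t k, fun X ψ _ hψ hX => ?_⟩
  have h1 := B.hasDerivAt_actSection_rotation isOpen_punctured hψ hkt
    (R := fun u => R t * (R u)⁻¹) (t := t) (mul_inv_cancel _) (hasDerivAt_mul_inv (hR t))
  simp only [rotation_mul, rotation_inv] at h1
  rw [B.rotationConnection_eq_covDeriv hψ hkt hX]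
  have h3 := B.hasDerivAt_act_symm (g := fun u => rotation (R u)) h1
  rw [B.covDeriv_cross ψ hkt (hΩ t)]
  exact h3

omit [VectorBundle ℂ F E] [VectorBundle ℝ F E] in
theorem scaledBoost_symm_apply (n : Metric.sphere (0 : R3) 1) (k : shell m) (η : ℝ)
    (x : E (boost n η • k)) : (B.scaledBoost n k η).symm x =
      (√(energy m (boost n η • k : shell m) / energy m k))⁻¹ • (B.act (boost n η) k).symm x := by
  have h : √(energy m (boost n η • k : shell m) / energy m k) ≠ 0 :=
    (Real.sqrt_pos.mpr (div_pos (boost n η • k : shell m).2 k.2)).ne'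
  rw [LinearEquiv.symm_apply_eq]
  change _ = ((√(energy m (boost n η • k : shell m) / energy m k) : ℝ) : ℂ) •
    B.act (boost n η) k _
  rw [← Complex.coe_smul, map_smul, smul_smul, ← Complex.ofReal_mul, mul_inv_cancel₀ h,
    LinearIsometryEquiv.apply_symm_apply, Complex.ofReal_one, one_smul]

end ParticleBundle

theorem energy_boost_smul (n : Metric.sphere (0 : R3) 1) (η : ℝ) (k : shell m) :
    energy m (boost n η • k : shell m) =
      Real.cosh η * energy m k + Real.sinh η * inner ℝ (n : R3) (k : R3) :=
  congrArg Prod.fst (fourMomentum_smul (boost n η) k)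

theorem coe_boost_smul (n : Metric.sphere (0 : R3) 1) (η : ℝ) (k : shell m) :
    ((boost n η • k : shell m) : R3) = k + (Real.sinh η * energy m k +
      (Real.cosh η - 1) * inner ℝ (n : R3) (k : R3)) • (n : R3) := rfl

theorem inner_boost_smul (n : Metric.sphere (0 : R3) 1) (η : ℝ) (k : shell m) :
    (inner ℝ (n : R3) (boost n η • k : shell m) : ℝ) =
      Real.sinh η * energy m k + Real.cosh η * inner ℝ (n : R3) (k : R3) := by
  rw [coe_boost_smul, inner_add_right, inner_smul_right, real_inner_self_eq_norm_sq,
    norm_eq_of_mem_sphere]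
  ring

theorem hasDerivAt_boost_smul (n : Metric.sphere (0 : R3) 1) (η : ℝ) (k : shell m) :
    HasDerivAt (fun η => ((boost n η • k : shell m) : R3))
      (energy m (boost n η • k : shell m) • (n : R3)) η := by
  rw [energy_boost_smul]
  simp only [coe_boost_smul]
  exact (((((Real.hasDerivAt_sinh η).mul_const _).add
    (((Real.hasDerivAt_cosh η).sub_const 1).mul_const _)).smul_const (n : R3)).const_add (k : R3))

theorem hasDerivAt_energy_boost_smul (n : Metric.sphere (0 : R3) 1) (η : ℝ) (k : shell m) :
    HasDerivAt (fun η => energy m (boost n η • k : shell m))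
      (inner ℝ (n : R3) (boost n η • k : shell m)) η := by
  simp only [inner_boost_smul, energy_boost_smul]
  exact ((Real.hasDerivAt_cosh η).mul_const _).add ((Real.hasDerivAt_sinh η).mul_const _)

namespace ParticleBundle

omit [VectorBundle ℂ F E] in
theorem isParallelTransport_boost (n : Metric.sphere (0 : R3) 1) (r : ℝ)
    (hr : (k : R3) = r • (n : R3)) :
    IsParallelTransport F B.rotationConnection (punctured m) (fun η => boost n η • k)
      {η | 0 < (inner ℝ (n : R3) (boost n η • k : shell m) : ℝ)}
      (fun η => B.scaledBoost n k η) := by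
  intro t ht
  obtain ⟨s, hs⟩ : ∃ s, s = (inner ℝ (n : R3) (boost n t • k : shell m) : ℝ) := ⟨_, rfl⟩
  rw [Set.mem_ofPred_eq, ← hs] at ht
  have hn1 : ‖(n : R3)‖ = 1 := norm_eq_of_mem_sphere n
  have hks : ((boost n t • k : shell m) : R3) = s • (n : R3) := by
    rw [hs, inner_boost_smul, coe_boost_smul, hr, inner_smul_right, real_inner_self_eq_norm_sq, hn1]
    module
  have hns : ‖((boost n t • k : shell m) : R3)‖ = s := by
    rw [hks, norm_smul, hn1, mul_one, Real.norm_of_nonneg ht.le]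
  have hkt : boost n t • k ∈ punctured m := norm_pos_iff.mp (by rw [hns]; exact ht)
  refine ⟨hkt, _, hasDerivAt_boost_smul n t k, fun X ψ _ hψ hX => ?_⟩
  rw [B.rotationConnection_eq_covDeriv hψ hkt hX]
  have hE := hasDerivAt_energy_boost_smul n t k
  rw [← hs] at hE
  have hωt := energy_pos (boost n t • k)
  have hω := energy_pos k
  have h1 : HasDerivAt (fun u => B.actSection (boost n t * (boost n u)⁻¹) ψ (boost n t • k))
      (-B.lie boostFamily ψ (boost n t • k) n) t := by
    simp only [← boost_neg, ← boost_add, ← sub_eq_add_neg]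
    have h2 := HasDerivAt.scomp (h := fun u => t - u) t
      (by rw [sub_self]; exact B.hasDerivAt_actSection_boost isOpen_punctured hψ hkt n)
      ((hasDerivAt_id t).const_sub t)
    exact h2.congr_deriv (by simp)
  have h3 := B.hasDerivAt_act_symm (g := fun u => boost n u) h1
  have h4 := ((hE.div_const (energy m k)).sqrt (div_pos hωt hω).ne').inv
    (Real.sqrt_pos.mpr (div_pos hωt hω)).ne'
  simp only [scaledBoost_symm_apply]
  refine (h4.smul h3).congr_deriv ?_
  -- the scalar term is the logarithmic derivative of the normalizing factor
  rw [B.covDeriv_radial ψ hn1 ht hks, map_sub, map_smul, map_neg, Complex.coe_smul]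
  have h11 : √(energy m (boost n t • k : shell m) / energy m k) ^ 2 =
    energy m (boost n t • k : shell m) / energy m k := Real.sq_sqrt (div_pos hωt hω).le
  have h12 := (Real.sqrt_pos.mpr (div_pos hωt hω)).ne'
  simp only [Pi.inv_apply]
  generalize √(energy m (boost n t • k : shell m) / energy m k) = q at h11 h12 ⊢
  generalize (B.act (boost n t) k).symm (B.lie boostFamily ψ (boost n t • k) n) = x
  generalize (B.act (boost n t) k).symm (ψ (boost n t • k)) = y
  generalize energy m (boost n t • k : shell m) = e' at h11 hωt ⊢
  generalize energy m k = e at h11 hω ⊢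
  clear h1 h3 h4 hE
  match_scalars
  · field_simp
  · field_simp at h11 ⊢
    rw [h11]

end ParticleBundle

end

/-! ### Anti-Hermiticity -/

section

variable {m : ℝ}

theorem measurable_energyDensity :
    Measurable fun k : shell m => ENNReal.ofReal (energy m k)⁻¹ := by
  have h : Continuous (energy m) := by unfold energy; fun_prop
  exact (h.measurable.comp measurable_subtype_coe).inv.ennreal_ofReal

theorem integrable_invMeasure_iff (f : shell m → ℂ) :
    Integrable f (invMeasure m) ↔
      Integrable (fun x : R3 => (energy m x)⁻¹ • extendZero f x) := by
  have hs : MeasurableSet (shell m : Set R3) := (shell m).isOpen.measurableSet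
  rw [invMeasure, integrable_withDensity_iff_integrable_smul' measurable_energyDensity
    (Filter.Eventually.of_forall fun _ => ENNReal.ofReal_lt_top)]
  have h1 : (fun k : shell m => (ENNReal.ofReal (energy m k)⁻¹).toReal • f k) =
      (fun x : R3 => (energy m x)⁻¹ • extendZero f x) ∘ Subtype.val := by
    funext k
    rw [ENNReal.toReal_ofReal (inv_nonneg.mpr (energy_pos k).le), Function.comp_apply,
      extendZero_coe]
  rw [h1]
  refine ((MeasurableEmbedding.subtype_coe hs).integrable_map_iff).symm.trans ?_
  have h2 := map_comap_subtype_coe hs (volume : Measure R3)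
  refine Iff.trans
    (b := IntegrableOn (fun x : R3 => (energy m x)⁻¹ • extendZero f x) (shell m)) ?_ ?_
  · rw [IntegrableOn, ← h2]; rfl
  · refine integrableOn_iff_integrable_of_support_subset fun x hx => ?_
    by_contra h
    refine hx ?_
    simp only [extendZero]
    rw [Function.extend_apply' _ _ _ (by rintro ⟨a, rfl⟩; exact h a.2)]
    exact smul_zero _

theorem integral_invMeasure (f : shell m → ℂ) :
    ∫ k, f k ∂(invMeasure m) = ∫ x : R3, (energy m x)⁻¹ • extendZero f x := by
  have hs : MeasurableSet (shell m : Set R3) := (shell m).isOpen.measurableSet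
  rw [invMeasure, integral_withDensity_eq_integral_toReal_smul measurable_energyDensity
    (Filter.Eventually.of_forall fun _ => ENNReal.ofReal_lt_top)]
  have h1 : (fun k : shell m => (ENNReal.ofReal (energy m k)⁻¹).toReal • f k) =
      fun k : shell m => (fun x : R3 => (energy m x)⁻¹ • extendZero f x) k := by
    funext k
    simp only [ENNReal.toReal_ofReal (inv_nonneg.mpr (energy_pos k).le), extendZero_coe]
  rw [h1]
  refine (integral_subtype_comap hs
    (fun x : R3 => (energy m x)⁻¹ • extendZero f x)).trans
    (setIntegral_eq_integral_of_forall_compl_eq_zero fun x hx => ?_)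
  simp only [extendZero]
  rw [Function.extend_apply' _ _ _ (by rintro ⟨a, rfl⟩; exact hx a.2)]
  exact smul_zero _

/-- The integral of a partial derivative vanishes if the function and the derivative are integrable
and the function is differentiable off the origin. By Fubini this follows from the fundamental
theorem of calculus on the lines in the given direction, almost all of which avoid the origin. -/
theorem integral_fderiv_eq_zero {u : R3 → ℂ} {u' : R3 → R3 →L[ℝ] ℂ} (a : Fin 3)
    (hu : Integrable u) (hu' : Integrable fun x => u' x (EuclideanSpace.single a 1))
    (h : ∀ x, x ≠ 0 → HasFDerivAt u (u' x) x) :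
    ∫ x, u' x (EuclideanSpace.single a 1) = 0 := by
  let e : R3 ≃ᵐ ℝ × (Fin 2 → ℝ) :=
    (MeasurableEquiv.toLp 2 (Fin 3 → ℝ)).symm.trans (MeasurableEquiv.piFinSuccAbove (fun _ => ℝ) a)
  have he : MeasurePreserving e.symm :=
    ((volume_preserving_piFinSuccAbove (fun _ : Fin 3 => ℝ) a).comp
      (PiLp.volume_preserving_ofLp (Fin 3))).symm e
  have hes : ∀ t y, e.symm (t, y) = WithLp.toLp 2 (Fin.insertNth a t y : Fin 3 → ℝ) :=
    fun t y => rfl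
  rw [← he.integral_comp' (g := fun x => u' x (EuclideanSpace.single a 1))]
  have hi := he.integrable_comp_of_integrable hu
  have hi' := he.integrable_comp_of_integrable hu'
  refine (integral_prod_symm _ hi').trans ?_
  refine integral_eq_zero_of_ae ?_
  have hy0 : ∀ᵐ y : Fin 2 → ℝ, y ≠ 0 := by
    rw [ae_iff]; simp
  filter_upwards [hi.prod_left_ae, hi'.prod_left_ae, hy0] with y hy hy' hy0
  refine integral_eq_zero_of_hasDerivAt_of_integrable (f := fun t => u (e.symm (t, y)))
    (fun t => ?_) hy' hy
  have hne : e.symm (t, y) ≠ 0 := by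
    intro h0
    refine hy0 ?_
    funext j
    have := congrArg (fun x : R3 => x (a.succAbove j)) h0
    simpa [hes] using this
  refine (h _ hne).comp_hasDerivAt t (f := fun t => e.symm (t, y)) ?_
  simp only [hes]
  refine hasDerivAt_euclidean.mpr fun i => ?_
  rcases Fin.eq_self_or_eq_succAbove a i with rfl | ⟨j, rfl⟩
  · simpa using hasDerivAt_id' t
  · simpa using hasDerivAt_const t (y j)

variable {F : Type*} [NormedAddCommGroup F] [NormedSpace ℂ F]
  {E : shell m → Type*} [TopologicalSpace (TotalSpace F E)]
  [∀ k, NormedAddCommGroup (E k)] [∀ k, InnerProductSpace ℂ (E k)]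
  [FiberBundle F E]
  {U : Set (shell m)} {ψ ζ : ∀ k, E k} {k : shell m}

theorem ae_mem_punctured : ∀ᵐ k ∂(invMeasure m), k ∈ punctured m := by
  have h : ∀ᵐ k ∂(Measure.comap ((↑) : shell m → R3) volume), k ∈ punctured m := by
    have h1 : ∀ᵐ x : R3, x ≠ 0 := by rw [ae_iff]; simp
    have hs : MeasurableSet (shell m : Set R3) := (shell m).isOpen.measurableSet
    have h2 := ae_restrict_of_ae (s := (shell m : Set R3)) h1
    rw [← map_comap_subtype_coe hs] at h2
    exact (MeasurableEmbedding.subtype_coe hs).ae_map_iff.mp h2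
  exact (withDensity_absolutelyContinuous _ _) h

theorem ParticleBundle.integrable_inner (B : ParticleBundle F E)
    (hψ : SmoothSection F (punctured m) ψ) (hζ : SmoothSection F (punctured m) ζ)
    (hψ2 : SquareIntegrable ψ) (hζ2 : SquareIntegrable ζ) :
    Integrable (fun k => inner ℂ (ψ k) (ζ k)) (invMeasure m) := by
  refine (hψ2.add hζ2).mono' ?_ (Filter.Eventually.of_forall fun k => ?_)
  · have h1 := (B.smooth_inner _ isOpen_punctured ψ ζ hψ hζ).continuousOn
    have h2 := h1.aestronglyMeasurable (μ := invMeasure m) isOpen_punctured.measurableSet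
    rwa [Measure.restrict_eq_self_of_ae_mem ae_mem_punctured] at h2
  · refine (norm_inner_le_norm (𝕜 := ℂ) _ _).trans ?_
    rw [Pi.add_apply]
    nlinarith [sq_nonneg (‖ψ k‖ - ‖ζ k‖), sq_nonneg ‖ψ k‖, sq_nonneg ‖ζ k‖]

variable [VectorBundle ℂ F E] [VectorBundle ℝ F E] (B : ParticleBundle F E)

theorem ParticleBundle.isAntiHermitianOn_rotationConnection :
    IsAntiHermitianOn F B.rotationConnection (punctured m) := by
  intro a ψ ζ hψ hζ hψ2 hζ2 hDψ2 hDζ2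
  have hX : SmoothField (punctured m) (constField a) := fun b => contMDiffOn_const
  have hDψ := B.isConnectionOn_rotationConnection.smooth _ _ hX hψ
  have hDζ := B.isConnectionOn_rotationConnection.smooth _ _ hX hζ
  have hcov : ∀ {χ : ∀ k, E k}, SmoothSection F (punctured m) χ → ∀ k ∈ punctured m,
      B.rotationConnection (constField a) χ k = B.covDeriv χ k (EuclideanSpace.single a 1) :=
    fun hχ k hk => B.rotationConnection_eq_covDeriv hχ hk fun b => by
      by_cases hb : b = a <;> simp [constField, hb]
  have hi := B.integrable_inner hψ hζ hψ2 hζ2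
  have hi1 := B.integrable_inner hDψ hζ hDψ2 hζ2
  have hi2 := B.integrable_inner hψ hDζ hψ2 hDζ2
  set h : shell m → ℂ := fun k => inner ℂ (ψ k) (ζ k) with hh
  have hhs := B.smooth_inner _ isOpen_punctured ψ ζ hψ hζ
  -- the integrand, divided by the energy, is the partial derivative of `⟨ψ, ζ⟩ / ω`
  have key : ∫ k, (inner ℂ (B.rotationConnection (constField a) ψ k) (ζ k) +
      inner ℂ (ψ k) (B.rotationConnection (constField a) ζ k)) ∂(invMeasure m) = 0 := by
    have hi3 := hi1.add hi2
    rw [integrable_invMeasure_iff] at hi hi3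
    rw [integral_invMeasure]
    set u : R3 → ℂ := fun x => (energy m x)⁻¹ • extendZero h x with hu
    have hx : ∀ x : R3, x ≠ 0 → 0 < energy m x := fun x hx =>
      Real.sqrt_pos.mpr (by have := norm_pos_iff.mpr hx; positivity)
    have hder : ∀ k : shell m, k ∈ punctured m → HasFDerivAt u _ (k : R3) := fun k hk =>
      ((hasDerivAt_inv (energy_pos k).ne').comp_hasFDerivAt (k : R3) (hasFDerivAt_energy k)).smul
        ((contDiffAt_extendZero ((hhs k hk).contMDiffAt
          (isOpen_punctured.mem_nhds hk))).differentiableAt (by simp)).hasFDerivAt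
    have hval : ∀ k : shell m, k ∈ punctured m → fderiv ℝ u (k : R3) (EuclideanSpace.single a 1) =
        (energy m k)⁻¹ • (inner ℂ (B.rotationConnection (constField a) ψ k) (ζ k) +
          inner ℂ (ψ k) (B.rotationConnection (constField a) ζ k)) := by
      intro k hk
      rw [(hder k hk).fderiv, hcov hψ k hk, hcov hζ k hk,
        B.inner_covDeriv_add_inner_covDeriv hψ hζ hk, hh]
      have hω : ((energy m k : ℝ) : ℂ) ≠ 0 := Complex.ofReal_ne_zero.mpr (energy_pos k).ne'
      simp
      field_simp
      ring
    have hae : (fun x : R3 => fderiv ℝ u x (EuclideanSpace.single a 1)) =ᵐ[volume]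
        fun x => (energy m x)⁻¹ • extendZero (fun k =>
          inner ℂ (B.rotationConnection (constField a) ψ k) (ζ k) +
          inner ℂ (ψ k) (B.rotationConnection (constField a) ζ k)) x := by
      have h1 : ∀ᵐ x : R3, x ≠ 0 := by rw [ae_iff]; simp
      filter_upwards [h1] with x hx0
      have h2 := hval ⟨x, hx x hx0⟩ hx0
      rw [h2, ← extendZero_coe (fun k =>
          inner ℂ (B.rotationConnection (constField a) ψ k) (ζ k) +
          inner ℂ (ψ k) (B.rotationConnection (constField a) ζ k)) ⟨x, hx x hx0⟩]
    rw [← integral_congr_ae hae]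
    refine integral_fderiv_eq_zero a hi (hi3.congr hae.symm) fun x hx0 => ?_
    exact (hder ⟨x, hx x hx0⟩ hx0).differentiableAt.hasFDerivAt
  rw [integral_add hi1 hi2] at key
  simp only [secInner, Pi.smul_apply, inner_smul_left, inner_smul_right, integral_const_mul,
    Complex.conj_I]
  linear_combination -Complex.I * key

end

end Particle

end

open Particle in
theorem theorem7 {m : ℝ} (hm : 0 ≤ m)
    {F : Type*} [NormedAddCommGroup F] [NormedSpace ℂ F] [FiniteDimensional ℂ F]
    {E : shell m → Type*} [TopologicalSpace (TotalSpace F E)]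
    [∀ k, NormedAddCommGroup (E k)] [∀ k, InnerProductSpace ℂ (E k)]
    [FiberBundle F E] [VectorBundle ℂ F E] [VectorBundle ℝ F E]
    [ContMDiffVectorBundle ∞ F E 𝓘(ℝ, R3)] (B : ParticleBundle F E) :
    -- the two expressions for the components of `D^R` agree
    (∀ (a : Fin 3) (ψ : ∀ k, E k), SmoothSection F (punctured m) ψ →
      ∀ k ∈ punctured m, B.rotationComp a ψ k = B.rotationCompSymm a ψ k) ∧
    -- `D^R` is an anti-Hermitian connection away from the origin
    IsConnectionOn F B.rotationConnection (punctured m) ∧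
    IsAntiHermitianOn F B.rotationConnection (punctured m) ∧
    -- transport along spheres: rotations without twist, i.e. whose angular velocity `Ω`
    -- is orthogonal to the momentum
    (∀ (k : shell m) (R : ℝ → SO3) (Ω : ℝ → R3), k ∈ punctured m → R 0 = 1 →
      (∀ i j, ContDiff ℝ ∞ (fun t => (R t).1 i j)) →
      (∀ (t : ℝ) (x : R3), HasDerivAt (fun u => Matrix.toEuclideanLin (R u).1 x)
        (cross (Ω t) (Matrix.toEuclideanLin (R t).1 x)) t) →
      (∀ t, inner ℝ (Ω t) (rotation (R t) • k : shell m) = (0 : ℝ)) →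
      IsParallelTransport F B.rotationConnection (punctured m)
        (fun t => rotation (R t) • k) Set.univ
        (fun t => (B.act (rotation (R t)) k).toLinearEquiv)) ∧
    -- radial transport: boosts, normalized by the factor `(ω(k') / ω(k))^{1/2}`
    (∀ (k : shell m) (n : Metric.sphere (0 : R3) 1) (r : ℝ), 0 < r → (k : R3) = r • (n : R3) →
      IsParallelTransport F B.rotationConnection (punctured m)
        (fun η => boost n η • k)
        {η | 0 < (inner ℝ (n : R3) (boost n η • k : shell m) : ℝ)}
        (fun η => B.scaledBoost n k η)) := by
  exact ⟨fun a _ hψ _ hk => B.rotationComp_eq_rotationCompSymm hψ hk a,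
    B.isConnectionOn_rotationConnection,
    B.isAntiHermitianOn_rotationConnection,
    fun _ _ _ hk _ _ hR hΩ => B.isParallelTransport_rotation hk hR hΩ,
    fun _ n r _ hr => B.isParallelTransport_boost n r hr⟩
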